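/- Let $d\ge 1$. Let $\Omega\subset\mathbb{R}^d$ be a bounded domain (non-empty, open, connected) centered at the origin, i.e. the smallest closed ball containing $\Omega$ has its center at $0$, and let $\omega=\mathbb{R}^d\setminus\overline{\Omega}$. For $0<T<\infty$, let $\kappa_1\in C^1([0,T])$ be bounded below by a positive constant, let $\kappa_2\in C([0,T])$ with $\kappa_2\ge 0$, and consider $$\partial_t u+i\left(-\kappa_1(t)\Delta+\kappa_2(t)|x|^2\right)u=0\quad (0<t\le T,\ x\in\mathbb{R}^d),\qquad u(0)=u_0. \tag{1}$$ Let $B=\{u\in L^2(\mathbb{R}^d): x^\alpha D_x^\beta u\in L^2(\mathbb{R}^d)\text{ for all } |\alpha+\beta|\le 2\}$ with $\|u\|_B^2=\sum_{|\alpha+\beta|=2}\|x^\alpha D_x^\beta u\|_{L^2}^2$. A solution of (1) is a $B$-valued solution: $u\in C^0([0,T],B)\cap C^1([0,T],L^2(\mathbb{R}^d))$ with (1) satisfied in $L^2(\mathbb{R}^d)$. Assume that the Hamiltonian $\kappa_1(t)|p|^2+\kappa_2(t)|x|^2$ is non-zero on $[0,T]$: the solution of $x_i'=2\kappa_1p_i$,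 $p_i'=-2\kappa_2x_i$, $x_i(0)=1$, $p_i(0)=0$ ($i=1,\dots,d$) satisfies $x_i(t)\ne 0$ for all $t\in[0,T]$ and all $i$, and $t\mapsto\exp\left(-\int_0^t \frac{p_i(s)\kappa_1(s)}{x_i(s)}\,ds\right)$ is bounded on $[0,T]$. Let $y_1,y_2,y_3$ solve on $[0,T]$ the Riccati system $$y_1'=-4\kappa_1y_1^2-\kappa_2,\quad y_2'=-4\kappa_1y_1y_2,\quad y_3'=-\kappa_1y_2^2,\qquad y_1(0)=0,\ y_2(0)=1,\ y_3(0)=0.$$ Let $\mathcal{A}$ be the class of all $u_0\in B$ for which there are $N\in\mathbb{N}$ with $N>2$, $\eta\in(0,1)$ and, for every multi-index $n\in\{0,\dots,N\}^d$ with $|n|\le N$, a point $\tilde a_n\in\mathbb{R}^d$ and a coefficient $\tilde c_n\ge 0$ such that $$\Big\|u_0-\sum_{|n|\le N}\tilde c_n e^{-|x+\tilde a_n|^2}\Big\|_{L^2(\mathbb{R}^d)}\le\eta ,$$ and put $|\alpha_N|=\max_{n,m}|\tilde a_n-\tilde a_m|$. Then there is a constant $C_T>0$, depending only on $T$, $\Omega$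 (and $d$), the $L^\infty([0,T])$ norm of $\kappa_2$ and the $C^1([0,T])$ norm of $\kappa_1$ (and not on $u_0$, $N$, $\eta$, $\tilde a_n$, $\tilde c_n$), such that every solution $u$ of (1) with $u_0\in\mathcal{A}$ (with such $N,\eta,\tilde a_n,\tilde c_n$) satisfies $$\|u_0\|_{L^2(\mathbb{R}^d)}-\eta\le C_T\left(\|u\|_{L^2((0,T)\times\omega)}+T\eta\right),$$ provided that for all $t\in[0,T)$ $$\max_n|\tilde a_n|>\sqrt{\frac{|\alpha_N|^2+2-2\log\left(\sqrt{|y_2(t)|(1+16y_3(t)^2)^{-1}}\right)}{4\,y_2(t)^2(1+16y_3(t)^2)^{-1}}}+\frac{|\alpha_N|}{y_2(t)}+\frac{\mathrm{diam}(\Omega)}{2}, \tag{R1}$$ where $\sqrt{s}$ is read as $0$ should $s$ be negative. -/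

import Mathlib

open Set MeasureTheory TemperedDistribution
open scoped SchwartzMap LineDeriv Laplacian NNReal

noncomputable section

/-- The Euclidean space `ℝ^d`. -/
abbrev Eucl (d : ℕ) : Type := EuclideanSpace ℝ (Fin d)

/-- The complex Hilbert space `L²(ℝ^d)` with respect to Lebesgue measure. -/
abbrev L2 (d : ℕ) : Type := Lp ℂ 2 (volume : Measure (Eucl d))

/-- The tempered distribution `x_{a 0} ⋯ x_{a (k-1)} ∂_{b 0} ⋯ ∂_{b (l-1)} u`. Every `x^α ∂^β` with
multi-indices of orders `|α| = k`, `|β| = l` is of this form, and conversely. (Derivatives `∂` are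
used in place of `D = -i ∂`; the unimodular factors change neither membership in `L²` nor norms.) -/
def weightedDeriv {d k l : ℕ} (a : Fin k → Fin d) (b : Fin l → Fin d) (u : L2 d) :
    𝓢'(Eucl d, ℂ) :=
  smulLeftCLM ℂ (fun x : Eucl d => ∏ i, ((x (a i) : ℝ) : ℂ))
    (∂^{fun i => EuclideanSpace.single (b i) (1 : ℝ)} (u : 𝓢'(Eucl d, ℂ)))

/-- The space `B` of all `u ∈ L²` with `x^α D^β u ∈ L²` for all multi-indices with `|α + β| ≤ 2`. -/
def MemB {d : ℕ} (u : L2 d) : Prop :=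
  ∀ (k l : ℕ) (a : Fin k → Fin d) (b : Fin l → Fin d), k + l ≤ 2 →
    ∃ g : L2 d, weightedDeriv a b u = (g : 𝓢'(Eucl d, ℂ))

/-- `u ∈ C⁰(S, B)`, where the norm of `B` is
`(∑_{|α + β| = 2} ‖x^α D^β u‖²_{L²})^{1/2}`: all values lie in `B`, and all `x^α D^β u` with
`|α + β| = 2` are continuous on `S` as `L²`-valued maps. -/
def ContinuousOnB {d : ℕ} (u : ℝ → L2 d) (S : Set ℝ) : Prop :=
  (∀ t ∈ S, MemB (u t)) ∧
  ∀ (k l : ℕ) (a : Fin k → Fin d) (b : Fin l → Fin d), k + l = 2 →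
    ∃ g : ℝ → L2 d, ContinuousOn g S ∧
      ∀ t ∈ S, weightedDeriv a b (u t) = (g t : 𝓢'(Eucl d, ℂ))

/-- The operator `L(t) u = -κ₁(t) Δu + κ₂(t) |x|² u`, for the values `k₁ = κ₁(t)`, `k₂ = κ₂(t)`. -/
def oscillator {d : ℕ} (k₁ k₂ : ℝ) (u : L2 d) : 𝓢'(Eucl d, ℂ) :=
  -((k₁ : ℂ) • Δ (u : 𝓢'(Eucl d, ℂ))) +
    (k₂ : ℂ) • smulLeftCLM ℂ (fun x : Eucl d => ((‖x‖ ^ 2 : ℝ) : ℂ)) (u : 𝓢'(Eucl d, ℂ))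

/-- `u` is a `B`-valued solution on `[0,T]` of `∂ₜ u + i L(t) u = 0`, `u(0) = u₀`:
`u ∈ C⁰([0,T], B) ∩ C¹([0,T], L²)`, and the equation holds in `L²` for `0 < t ≤ T`
(both of its terms are in `L²`, which is embedded in the tempered distributions). -/
structure IsBValuedSolution {d : ℕ} (T : ℝ) (κ₁ κ₂ : ℝ → ℝ) (u₀ : L2 d) (u : ℝ → L2 d) :
    Prop where
  continuousOnB : ContinuousOnB u (Icc 0 T)
  contDiff_and_equation : ∃ u' : ℝ → L2 d, ContinuousOn u' (Icc 0 T) ∧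
    (∀ t ∈ Icc 0 T, HasDerivWithinAt u (u' t) (Icc 0 T) t) ∧
    ∀ t ∈ Ioc 0 T,
      (u' t : 𝓢'(Eucl d, ℂ)) + Complex.I • oscillator (κ₁ t) (κ₂ t) (u t) = 0
  initial : u 0 = u₀

/-- The Hamiltonian trajectory on `[0,T]` of `κ₁(t)|p|² + κ₂(t)|x|²` starting at
`x(0) = (1,…,1)`, `p(0) = (0,…,0)`. -/
structure IsHamiltonianTrajectory {d : ℕ} (T : ℝ) (κ₁ κ₂ : ℝ → ℝ) (x p : ℝ → Eucl d) :
    Prop where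
  deriv_x : ∀ t ∈ Icc 0 T, ∀ i : Fin d,
    HasDerivWithinAt (fun s => x s i) (2 * κ₁ t * p t i) (Icc 0 T) t
  deriv_p : ∀ t ∈ Icc 0 T, ∀ i : Fin d,
    HasDerivWithinAt (fun s => p s i) (-2 * κ₂ t * x t i) (Icc 0 T) t
  init_x : ∀ i, x 0 i = 1
  init_p : ∀ i, p 0 i = 0

/-- The Hamiltonian is non-zero on `[0,T]`: along the trajectory above, no coordinate of `x`
vanishes and the amplitude `exp(-∫₀ᵗ p_i κ₁ / x_i)` is bounded. -/
def NonzeroHamiltonian (d : ℕ) (T : ℝ) (κ₁ κ₂ : ℝ → ℝ) : Prop :=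
  ∃ x p : ℝ → Eucl d, IsHamiltonianTrajectory T κ₁ κ₂ x p ∧
    (∀ t ∈ Icc 0 T, ∀ i, x t i ≠ 0) ∧
    ∀ i, ∃ K : ℝ, ∀ t ∈ Icc 0 T,
      Real.exp (-∫ s in (0 : ℝ)..t, p s i * κ₁ s / x s i) ≤ K

/-- The Riccati system on `[0,T]` with its initial conditions. -/
structure IsRiccatiSolution (T : ℝ) (κ₁ κ₂ y₁ y₂ y₃ : ℝ → ℝ) : Prop where
  deriv₁ : ∀ t ∈ Icc 0 T,
    HasDerivWithinAt y₁ (-4 * κ₁ t * y₁ t ^ 2 - κ₂ t) (Icc 0 T) t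
  deriv₂ : ∀ t ∈ Icc 0 T,
    HasDerivWithinAt y₂ (-4 * κ₁ t * y₁ t * y₂ t) (Icc 0 T) t
  deriv₃ : ∀ t ∈ Icc 0 T,
    HasDerivWithinAt y₃ (-κ₁ t * y₂ t ^ 2) (Icc 0 T) t
  init₁ : y₁ 0 = 0
  init₂ : y₂ 0 = 1
  init₃ : y₃ 0 = 0

/-- The norm of `L^∞([0,T])`, for continuous functions. -/
def supNormOn (T : ℝ) (κ : ℝ → ℝ) : ℝ := ⨆ t : Icc (0 : ℝ) T, |κ t|

/-- The norm of `C¹([0,T])`. -/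
def c1NormOn (T : ℝ) (κ : ℝ → ℝ) : ℝ :=
  supNormOn T κ + supNormOn T (derivWithin κ (Icc 0 T))

/-- `Ω` is centered at the origin: the ball containing `Ω`, that is the smallest closed ball that
contains `Ω`, has its center at the origin. -/
def CenteredAtOrigin {d : ℕ} (Ω : Set (Eucl d)) : Prop :=
  ∃ r : ℝ, Ω ⊆ Metric.closedBall 0 r ∧
    ∀ (z : Eucl d) (s : ℝ), Ω ⊆ Metric.closedBall z s → r ≤ s

/-- The multi-indices `n = (n_1,…,n_d)` with `n_i ∈ {0,…,N}` and `|n| ≤ N`. -/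
def multiIndices (d N : ℕ) : Finset (Fin d → ℕ) :=
  (Fintype.piFinset fun _ => Finset.range (N + 1)).filter fun n => ∑ i, n i ≤ N

/-- The Gaussian sum `∑_{|n| ≤ N} c_n exp(-|x + a_n|²)`. -/
def gaussianSum {d : ℕ} (N : ℕ) (a : (Fin d → ℕ) → Eucl d) (c : (Fin d → ℕ) → ℝ) (x : Eucl d) :
    ℝ :=
  ∑ n ∈ multiIndices d N, c n * Real.exp (-‖x + a n‖ ^ 2)

/-- `f` belongs to the class `𝒜` of admissible functions, with the data `N`, `η`, `a_n`, `c_n`. -/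
structure IsAdmissibleWith {d : ℕ} (f : L2 d) (N : ℕ) (η : ℝ) (a : (Fin d → ℕ) → Eucl d)
    (c : (Fin d → ℕ) → ℝ) : Prop where
  two_lt : 2 < N
  eta_pos : 0 < η
  eta_lt_one : η < 1
  coeff_nonneg : ∀ n ∈ multiIndices d N, 0 ≤ c n
  approx : Real.sqrt (∫ x, ‖f x - (gaussianSum N a c x : ℂ)‖ ^ 2) ≤ η
  memB : MemB f

/-- `max_n |a_n|`. -/
def maxCenter {d : ℕ} (N : ℕ) (a : (Fin d → ℕ) → Eucl d) : ℝ :=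
  ((multiIndices d N).sup fun n => ‖a n‖₊ : ℝ≥0)

/-- The spread `|α_N| = max_{n,m} |a_n - a_m|`. -/
def spread {d : ℕ} (N : ℕ) (a : (Fin d → ℕ) → Eucl d) : ℝ :=
  ((multiIndices d N ×ˢ multiIndices d N).sup fun q => ‖a q.1 - a q.2‖₊ : ℝ≥0)

/-- The lower bound required of `max_n |a_n|`, for the spread `α`, the diameter `D` of `Ω` and the
values `y₂`, `y₃` of the Riccati solutions at one time. -/
def placementBound (α D y₂ y₃ : ℝ) : ℝ :=
  Real.sqrt ((α ^ 2 + 2 - 2 * Real.log (Real.sqrt (|y₂| * (1 + 16 * y₃ ^ 2)⁻¹))) /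
      (4 * y₂ ^ 2 * (1 + 16 * y₃ ^ 2)⁻¹)) +
    α / y₂ + D / 2

/-- The norm of `L²((0,T) × ω)`. -/
def observedNorm {d : ℕ} (T : ℝ) (ω : Set (Eucl d)) (u : ℝ → L2 d) : ℝ :=
  Real.sqrt (∫ t in Ioo 0 T, ∫ x in ω, ‖u t x‖ ^ 2)

end

/-! The evolution is an `L²` isometry, because `Δ` and multiplication by `|x|²` are symmetric. Hence
`u(t)` stays within `η` of the solution `v(t)` that starts from the Gaussian sum, and it is enough
that `v(t)` keeps a fixed fraction of its mass outside `closure Ω` during a short interval `[0,τ]`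
whose length depends on the coefficients only through their norm bounds.

The solution `v` is explicit. A complex Gaussian ansatz turns the equation into ODEs for the
coefficients of the exponent, and these are solved through the Riccati functions
(`exists_gaussian_path`). With `μ = (1 + 16 y₃²)⁻¹`, the solution starting from `exp(-|x + a|²)` has
modulus `(y₂² μ)^(d/4) exp(-μ |y₂ x + a|²)`. Bounding `|v(t)|` by the sum of the moduli and
expanding the square leaves pair interactions inside a ball that contains `Ω`. At time 0 there are
no phases, so `‖v(0)‖²` is exactly the weighted sum of the total pair interactions. Since the
weights `c_n c_m` are nonnegative, it suffices to compare pair by pair with a factor `θ < 1`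
(`exists_pair_interaction_le`, `setIntegral_sum_sq_le`).

By the parallelogram identity a pair interaction is the overlap `exp(-μ|a - b|²/2)` times a single
Gaussian placed by the midpoint of `a` and `b`. A single Gaussian that is not too narrow leaves a
fixed fraction of its mass outside the ball, wherever its center is. The loss `exp((1 - μ)|a -
b|²/2)` in the overlap is harmless for bounded spread if `τ` is small. For large spread, (R1) at `t
= 0` keeps every midpoint at distance at least half the spread from the origin, so the ball sees
only a tiny tail, which beats the loss. -/

noncomputable section

open Filter Topology FourierTransform

variable {d : ℕ}

/-! ### Symmetry of the Laplacian and the potential; conservation of the norm. -/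

theorem Lp.toTemperedDistribution_injective {f g : L2 d}
    (h : (f : 𝓢'(Eucl d, ℂ)) = (g : 𝓢'(Eucl d, ℂ))) : f = g := by
  have := Lp.ker_toTemperedDistributionCLM_eq_bot (F := ℂ) (μ := (volume : Measure (Eucl d)))
    (p := 2)
  exact LinearMap.ker_eq_bot.1 this h

open scoped ContDiff in
-- Both functions are locally integrable, so testing against smooth compactly supported functions,
-- which are Schwartz, identifies them almost everywhere.
theorem ae_eq_mul_of_smulLeftCLM_eq {g : Eucl d → ℂ} (hg : g.HasTemperateGrowth) {w h : L2 d}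
    (hw : smulLeftCLM ℂ g (w : 𝓢'(Eucl d, ℂ)) = (h : 𝓢'(Eucl d, ℂ))) :
    ∀ᵐ x, h x = g x * w x := by
  have hgc : Continuous g := hg.1.continuous
  have hwl : LocallyIntegrable (w : Eucl d → ℂ) := (Lp.memLp w).locallyIntegrable (by norm_num)
  have hhl : LocallyIntegrable (h : Eucl d → ℂ) := (Lp.memLp h).locallyIntegrable (by norm_num)
  refine ae_eq_of_integral_contDiff_smul_eq hhl ?_ ?_
  · rw [← locallyIntegrableOn_univ] at hwl ⊢
    exact hwl.continuousOn_mul hgc.continuousOn isClosed_univ.isLocallyClosed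
  · intro φ hφ hφc
    have hg₁ : HasCompactSupport (Complex.ofRealCLM ∘ φ) := hφc.comp_left rfl
    have hg₂ : ContDiff ℝ ∞ (Complex.ofRealCLM ∘ φ) := by fun_prop
    have := congrArg (fun D : 𝓢'(Eucl d, ℂ) => D (hg₁.toSchwartzMap hg₂)) hw
    simp [hg, Lp.toTemperedDistribution_apply] at this
    simp only [Complex.real_smul, ← this]
    refine integral_congr_ae (Filter.Eventually.of_forall fun x => ?_)
    simp
    ring

theorem inner_im_eq_zero_of_ae_eq {m : Eucl d → ℝ} {w h : L2 d}
    (hm : ∀ᵐ x, h x = (m x : ℂ) * w x) : (inner ℂ w h).im = 0 := by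
  rw [L2.inner_def, ← RCLike.im_eq_complex_im, ← integral_im (L2.integrable_inner w h)]
  refine integral_eq_zero_of_ae ?_
  filter_upwards [hm] with x hx
  simp [hx]
  ring

theorem inner_im_eq_zero_of_sq_norm_smul {w h : L2 d}
    (hw : smulLeftCLM ℂ (fun x : Eucl d => ((‖x‖ ^ 2 : ℝ) : ℂ)) (w : 𝓢'(Eucl d, ℂ)) =
      (h : 𝓢'(Eucl d, ℂ))) : (inner ℂ w h).im = 0 :=
  inner_im_eq_zero_of_ae_eq (ae_eq_mul_of_smulLeftCLM_eq (by fun_prop) hw)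

/-- By Plancherel, `Δ` becomes multiplication by the real symbol `-(2π)²|ξ|²`. Only `Δ w ∈ L²` is
needed; no boundary terms arise. -/
theorem inner_im_eq_zero_of_laplacian {w h : L2 d}
    (hw : Δ (w : 𝓢'(Eucl d, ℂ)) = (h : 𝓢'(Eucl d, ℂ))) : (inner ℂ w h).im = 0 := by
  rw [← Lp.inner_fourier_eq]
  have h1 : smulLeftCLM ℂ (fun x : Eucl d => ((-(2 * Real.pi) ^ 2 * ‖x‖ ^ 2 : ℝ) : ℂ))
      ((𝓕 w : L2 d) : 𝓢'(Eucl d, ℂ)) = ((𝓕 h : L2 d) : 𝓢'(Eucl d, ℂ)) := by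
    rw [← Lp.fourier_toTemperedDistribution_eq, ← Lp.fourier_toTemperedDistribution_eq, ← hw,
      TemperedDistribution.laplacian_eq_fourierMultiplierCLM]
    rw [fourierMultiplierCLM_apply, ← Complex.coe_smul, FourierTransform.fourier_smul,
      FourierTransform.fourier_fourierInv_eq, ← _root_.smul_apply,
      ← smulLeftCLM_smul (by fun_prop)]
    congr 2
    ext x
    simp
  exact inner_im_eq_zero_of_ae_eq (ae_eq_mul_of_smulLeftCLM_eq (by fun_prop) h1)

/-- Conservation of the `L²` norm. -/
theorem norm_eq_of_schrodinger {τ : ℝ} {κ₁ κ₂ : ℝ → ℝ} {w w' : ℝ → L2 d}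
    (hw : ∀ t ∈ Icc 0 τ, HasDerivWithinAt w (w' t) (Icc 0 τ) t)
    (heq : ∀ t ∈ Ioo 0 τ, ∃ g h : L2 d, Δ (w t : 𝓢'(Eucl d, ℂ)) = (g : 𝓢'(Eucl d, ℂ)) ∧
      smulLeftCLM ℂ (fun x : Eucl d => ((‖x‖ ^ 2 : ℝ) : ℂ)) (w t : 𝓢'(Eucl d, ℂ)) =
        (h : 𝓢'(Eucl d, ℂ)) ∧
      w' t = (Complex.I * κ₁ t) • g - (Complex.I * κ₂ t) • h) {t : ℝ} (ht : t ∈ Icc 0 τ) :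
    ‖w t‖ = ‖w 0‖ := by
  rcases ht.1.eq_or_lt with rfl | h0
  · rfl
  have hτ : 0 ≤ τ := ht.1.trans ht.2
  have key : ∀ s ∈ Ioo 0 t, HasDerivAt (fun s => ‖w s‖ ^ 2) 0 s := by
    intro s hs
    have hs' : s ∈ Ioo 0 τ := ⟨hs.1, hs.2.trans_le ht.2⟩
    have hd := (hw s (Ioo_subset_Icc_self hs')).hasDerivAt (Icc_mem_nhds hs'.1 hs'.2)
    have hi := hd.inner ℂ hd
    obtain ⟨g, h, hg, hh, he⟩ := heq s hs'
    have h1 := inner_im_eq_zero_of_laplacian hg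
    have h2 := inner_im_eq_zero_of_sq_norm_smul hh
    have e : inner ℂ (w s) (w' s) + inner ℂ (w' s) (w s) = 0 := by
      rw [← inner_conj_symm (w' s) (w s), he, inner_sub_right, inner_smul_right, inner_smul_right]
      generalize inner ℂ (w s) g = A at h1
      generalize inner ℂ (w s) h = B at h2
      apply Complex.ext <;> simp [h1, h2]
    rw [e] at hi
    have := Complex.reCLM.hasFDerivAt.comp_hasDerivAt s hi
    have hfun : (fun s => ‖w s‖ ^ 2) = Complex.reCLM ∘ fun t => inner ℂ (w t) (w t) := by
      ext r
      simp [inner_self_eq_norm_sq_to_K, ← Complex.ofReal_pow]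
    rw [hfun]
    simpa using this
  have hc : ContinuousOn (fun s => ‖w s‖ ^ 2) (Icc 0 t) := by
    have : ContinuousOn w (Icc 0 t) := fun s hs =>
      ((hw s ⟨hs.1, hs.2.trans ht.2⟩).continuousWithinAt).mono (Icc_subset_Icc_right ht.2)
    exact this.norm.pow 2
  obtain ⟨s, -, hs⟩ := exists_hasDerivAt_eq_slope _ _ h0 hc key
  have h2 : ‖w t‖ ^ 2 = ‖w 0‖ ^ 2 := by
    field_simp at hs
    linarith
  exact (sq_eq_sq₀ (norm_nonneg _) (norm_nonneg _)).1 h2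

/-! ### Differentiation of `L²`-valued paths. -/

theorem L2.norm_sq_eq_integral {X : Type*} [MeasurableSpace X] {μ : Measure X} (f : Lp ℂ 2 μ) :
    ‖f‖ ^ 2 = ∫ x, ‖f x‖ ^ 2 ∂μ := by
  have h := L2.inner_def (𝕜 := ℂ) f f
  rw [inner_self_eq_norm_sq_to_K] at h
  have : (∫ x, inner ℂ (f x) (f x) ∂μ) = ((∫ x, ‖f x‖ ^ 2 ∂μ : ℝ) : ℂ) := by
    rw [← integral_complex_ofReal]
    congr 1
    ext x
    rw [inner_self_eq_norm_sq_to_K]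
    simp
  rw [this] at h
  exact Complex.ofReal_injective (by simpa using h)

/-- The mean value inequality bounds the difference quotients by the same `g` as the derivative, so
`(2g)²` dominates the squared error and dominated convergence upgrades pointwise to `L²`
differentiability. -/
theorem hasDerivWithinAt_L2_of_dominated {I : Set ℝ} (hI : Convex ℝ I) {F F' : ℝ → Eucl d → ℂ}
    {v v' : ℝ → L2 d} {g : Eucl d → ℝ} (hg : MemLp g 2)
    (hv : ∀ t ∈ I, v t =ᵐ[volume] F t) (hv' : ∀ t ∈ I, v' t =ᵐ[volume] F' t)
    (hd : ∀ t ∈ I, ∀ x, HasDerivWithinAt (fun s => F s x) (F' t x) I t)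
    (hb : ∀ t ∈ I, ∀ x, ‖F' t x‖ ≤ g x) {t : ℝ} (ht : t ∈ I) :
    HasDerivWithinAt v (v' t) I t := by
  rw [hasDerivWithinAt_iff_tendsto_slope, tendsto_iff_norm_sub_tendsto_zero]
  have hae : ∀ s ∈ I \ {t}, slope v t s - v' t =ᵐ[volume]
      fun x => slope (fun r => F r x) t s - F' t x := by
    intro s hs
    rw [slope_def_module]
    filter_upwards [Lp.coeFn_sub ((s - t)⁻¹ • (v s - v t)) (v' t),
      Lp.coeFn_smul (s - t)⁻¹ (v s - v t), Lp.coeFn_sub (v s) (v t),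
      hv s hs.1, hv t ht, hv' t ht] with x h0 h1 h2 h3 h4 h5
    rw [h0, Pi.sub_apply, h1, Pi.smul_apply, h2, Pi.sub_apply, h3, h4, h5, slope_def_module]
  have key : Tendsto (fun s => ∫ x, ‖slope (fun r => F r x) t s - F' t x‖ ^ 2) (𝓝[I \ {t}] t)
      (𝓝 (∫ _ : Eucl d, (0 : ℝ))) := by
    refine tendsto_integral_filter_of_dominated_convergence (fun x => (2 * g x) ^ 2) ?_ ?_ ?_ ?_
    · filter_upwards [self_mem_nhdsWithin] with s hs
      exact ((Lp.aestronglyMeasurable _).congr (hae s hs)).norm.pow 2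
    · filter_upwards [self_mem_nhdsWithin] with s hs
      have hst : s - t ≠ 0 := sub_ne_zero.2 hs.2
      refine Eventually.of_forall fun x => ?_
      rw [Real.norm_of_nonneg (by positivity)]
      have hmv : ‖F s x - F t x‖ ≤ g x * ‖s - t‖ :=
        hI.norm_image_sub_le_of_norm_hasDerivWithin_le (fun r hr => hd r hr x)
          (fun r hr => hb r hr x) ht hs.1
      have h3 : ‖slope (fun r => F r x) t s‖ ≤ g x := by
        rw [slope_def_module, norm_smul, norm_inv, inv_mul_le_iff₀ (norm_pos_iff.2 hst)]
        linarith
      gcongr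
      calc _ ≤ _ := norm_sub_le _ _
        _ ≤ g x + g x := add_le_add h3 (hb t ht x)
        _ = _ := by ring
    · refine (hg.integrable_sq.const_mul 4).congr (Eventually.of_forall fun x => ?_)
      simp only
      ring
    · refine Eventually.of_forall fun x => ?_
      have h1 := hasDerivWithinAt_iff_tendsto_slope.1 (hd t ht x)
      have h2 := (h1.sub_const (F' t x)).norm.pow 2
      simpa using h2
  have h2 : Tendsto (fun s => ‖slope v t s - v' t‖ ^ 2) (𝓝[I \ {t}] t) (𝓝 0) := by
    rw [integral_zero] at key
    refine key.congr' ?_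
    filter_upwards [self_mem_nhdsWithin] with s hs
    rw [L2.norm_sq_eq_integral]
    refine integral_congr_ae ?_
    filter_upwards [hae s hs] with x hx
    rw [hx]
  have h3 := h2.sqrt
  simpa using h3

/-! ### Gaussian decay and integrability. -/

theorem integrable_exp_neg_mul_sq_norm {c : ℝ} (hc : 0 < c) :
    Integrable (fun x : Eucl d => Real.exp (-c * ‖x‖ ^ 2)) := by
  by_contra h
  have h1 := GaussianFourier.integral_rexp_neg_mul_sq_norm (V := Eucl d) hc
  rw [integral_undef h] at h1
  have : (0 : ℝ) < (Real.pi / c) ^ (Module.finrank ℝ (Eucl d) / 2 : ℝ) := by positivity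
  exact this.ne h1

theorem memLp_exp_neg_mul_sq {c : ℝ} (hc : 0 < c) :
    MemLp (fun x : Eucl d => Real.exp (-c * ‖x‖ ^ 2)) 2 := by
  rw [memLp_two_iff_integrable_sq (by fun_prop)]
  refine (integrable_exp_neg_mul_sq_norm (c := 2 * c) (by positivity)).congr
    (Eventually.of_forall fun x => ?_)
  simp only [← Real.exp_nat_mul]
  congr 1
  ring

theorem memLp_two_of_le_exp {f : Eucl d → ℂ} (hf : Continuous f) {c K : ℝ} (hc : 0 < c)
    (h : ∀ x, ‖f x‖ ≤ K * Real.exp (-c * ‖x‖ ^ 2)) : MemLp f 2 :=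
  (memLp_exp_neg_mul_sq hc).of_le_mul hf.aestronglyMeasurable
    (Eventually.of_forall fun x => by simpa using h x)

theorem integrable_of_le_exp {f : Eucl d → ℂ} (hf : Continuous f) {c K : ℝ} (hc : 0 < c)
    (h : ∀ x, ‖f x‖ ≤ K * Real.exp (-c * ‖x‖ ^ 2)) : Integrable f :=
  ((integrable_exp_neg_mul_sq_norm hc).const_mul K).mono' hf.aestronglyMeasurable
    (Eventually.of_forall h)

/-- Half of the decay rate `c` absorbs the linear term by completing the square, a quarter absorbs
the polynomial, and a quarter remains. -/
theorem exists_poly_mul_exp_le {c : ℝ} (hc : 0 < c) (B : ℝ) :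
    ∃ K, 0 ≤ K ∧ ∀ s : ℝ, (1 + s ^ 2) * Real.exp (-c * s ^ 2 + B * s) ≤
      K * Real.exp (-(c / 4) * s ^ 2) := by
  refine ⟨(1 + 4 / c) * Real.exp (B ^ 2 / (2 * c)), by positivity, fun s => ?_⟩
  have h1 : 1 + s ^ 2 ≤ (1 + 4 / c) * Real.exp (c / 4 * s ^ 2) := by
    have h2 := Real.add_one_le_exp (c / 4 * s ^ 2)
    have h3 : (1 + 4 / c) * (c / 4 * s ^ 2 + 1) = 1 + s ^ 2 + (c / 4 * s ^ 2 + 4 / c) := by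
      field_simp
      ring
    have h4 : 0 ≤ c / 4 * s ^ 2 + 4 / c := by positivity
    nlinarith [mul_le_mul_of_nonneg_left h2 (show 0 ≤ 1 + 4 / c by positivity)]
  have h5 : -c * s ^ 2 + B * s ≤ -(c / 2) * s ^ 2 + B ^ 2 / (2 * c) := by
    have : 0 ≤ (c * s - B) ^ 2 / (2 * c) := by positivity
    have e : (c * s - B) ^ 2 / (2 * c) = c / 2 * s ^ 2 - B * s + B ^ 2 / (2 * c) := by
      field_simp
      ring
    linarith
  calc _ ≤ ((1 + 4 / c) * Real.exp (c / 4 * s ^ 2)) *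
        Real.exp (-(c / 2) * s ^ 2 + B ^ 2 / (2 * c)) := by gcongr
    _ = (1 + 4 / c) * Real.exp (B ^ 2 / (2 * c)) *
        (Real.exp (c / 4 * s ^ 2) * Real.exp (-(c / 2) * s ^ 2)) := by
      rw [Real.exp_add]
      ring
    _ = _ := by
      rw [← Real.exp_add]
      ring_nf

/-! ### Distributional Laplacian from classical derivatives. -/

theorem SchwartzMap.integrable_mul (ψ : 𝓢(Eucl d, ℂ)) {g : Eucl d → ℂ} (hg : Integrable g) :
    Integrable (fun x => ψ x * g x) :=
  hg.bdd_mul (c := SchwartzMap.seminorm ℝ 0 0 ψ) ψ.continuous.aestronglyMeasurable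
    (Eventually.of_forall fun x => SchwartzMap.norm_le_seminorm ℝ ψ x)

/-- Integration by parts against a Schwartz function. -/
theorem integral_lineDeriv_mul_eq_neg {f f' : Eucl d → ℂ} {m : Eucl d} (hf : Integrable f)
    (hf' : Integrable f') (h : ∀ x, HasLineDerivAt ℝ f (f' x) x m) (φ : 𝓢(Eucl d, ℂ)) :
    ∫ x, (∂_{m} φ : 𝓢(Eucl d, ℂ)) x * f x = -∫ x, φ x * f' x := by
  have := integral_bilinear_hasLineDerivAt_right_eq_neg_left_of_integrable
    (μ := (volume : Measure (Eucl d))) (f := φ) (f' := (∂_{m} φ : 𝓢(Eucl d, ℂ))) (g := f)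
    (g' := f') (v := m) (B := ContinuousLinearMap.mul ℝ ℂ) ((∂_{m} φ).integrable_mul hf)
    (φ.integrable_mul hf') (φ.integrable_mul hf) ?_ (fun x _ => h x)
  · simp only [ContinuousLinearMap.mul_apply'] at this
    rw [this, neg_neg]
  · intro x _
    rw [SchwartzMap.lineDerivOp_apply]
    exact (φ.differentiableAt.lineDifferentiableAt).hasLineDerivAt

theorem laplacian_eq_of_hasLineDerivAt {f : Eucl d → ℂ} {f₁ f₂ : Fin d → Eucl d → ℂ}
    (hf : Integrable f) (hf₁ : ∀ i, Integrable (f₁ i)) (hf₂ : ∀ i, Integrable (f₂ i))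
    (h₁ : ∀ i x, HasLineDerivAt ℝ f (f₁ i x) x (EuclideanSpace.single i 1))
    (h₂ : ∀ i x, HasLineDerivAt ℝ (f₁ i) (f₂ i x) x (EuclideanSpace.single i 1))
    {v g : L2 d} (hv : v =ᵐ[volume] f) (hg : g =ᵐ[volume] fun x => ∑ i, f₂ i x) :
    Δ (v : 𝓢'(Eucl d, ℂ)) = (g : 𝓢'(Eucl d, ℂ)) := by
  ext φ
  rw [laplacian_apply_apply, Lp.toTemperedDistribution_apply, Lp.toTemperedDistribution_apply,
    SchwartzMap.laplacian_eq_sum (EuclideanSpace.basisFun (Fin d) ℝ)]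
  have e1 : ∫ x, (∑ i, ∂_{EuclideanSpace.basisFun (Fin d) ℝ i}
      (∂_{EuclideanSpace.basisFun (Fin d) ℝ i} φ) : 𝓢(Eucl d, ℂ)) x • v x =
      ∫ x, ∑ i : Fin d, (∂_{EuclideanSpace.single i (1 : ℝ)}
        (∂_{EuclideanSpace.single i (1 : ℝ)} φ) : 𝓢(Eucl d, ℂ)) x * f x := by
    refine integral_congr_ae ?_
    filter_upwards [hv] with x hx
    simp [hx, Finset.sum_mul]
  have e2 : ∫ x, φ x • g x = ∫ x, ∑ i, φ x * f₂ i x := by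
    refine integral_congr_ae ?_
    filter_upwards [hg] with x hx
    simp [hx, Finset.mul_sum]
  rw [e1, e2, integral_finsetSum _ fun i _ => SchwartzMap.integrable_mul _ hf,
    integral_finsetSum _ fun i _ => φ.integrable_mul (hf₂ i)]
  refine Finset.sum_congr rfl fun i _ => ?_
  rw [integral_lineDeriv_mul_eq_neg hf (hf₁ i) (h₁ i),
    integral_lineDeriv_mul_eq_neg (hf₁ i) (hf₂ i) (h₂ i), neg_neg]

theorem smulLeftCLM_eq_of_ae_eq_mul {m : Eucl d → ℂ} (hm : m.HasTemperateGrowth) {w h : L2 d}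
    (hw : ∀ᵐ x, h x = m x * w x) :
    smulLeftCLM ℂ m (w : 𝓢'(Eucl d, ℂ)) = (h : 𝓢'(Eucl d, ℂ)) := by
  ext φ
  rw [smulLeftCLM_apply_apply, Lp.toTemperedDistribution_apply, Lp.toTemperedDistribution_apply]
  refine integral_congr_ae ?_
  filter_upwards [hw] with x hx
  simp [hx, hm]
  ring

/-! ### The linear space of Schrödinger paths. -/

/-- A differentiable `L²`-valued path satisfying `w' = i κ₁ Δ w - i κ₂ |x|² w`. -/
def IsSchrodingerPath (τ : ℝ) (κ₁ κ₂ : ℝ → ℝ) (w : ℝ → L2 d) : Prop :=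
  ∃ w' : ℝ → L2 d, (∀ t ∈ Icc 0 τ, HasDerivWithinAt w (w' t) (Icc 0 τ) t) ∧
    ∀ t ∈ Ioo 0 τ, ∃ g h : L2 d, Δ (w t : 𝓢'(Eucl d, ℂ)) = (g : 𝓢'(Eucl d, ℂ)) ∧
      smulLeftCLM ℂ (fun x : Eucl d => ((‖x‖ ^ 2 : ℝ) : ℂ)) (w t : 𝓢'(Eucl d, ℂ)) =
        (h : 𝓢'(Eucl d, ℂ)) ∧
      w' t = (Complex.I * κ₁ t) • g - (Complex.I * κ₂ t) • h

theorem Lp.toTemperedDistribution_add (f g : L2 d) :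
    ((f + g : L2 d) : 𝓢'(Eucl d, ℂ)) = (f : 𝓢'(Eucl d, ℂ)) + (g : 𝓢'(Eucl d, ℂ)) :=
  map_add (Lp.toTemperedDistributionCLM ℂ (volume : Measure (Eucl d)) 2) f g

theorem Lp.toTemperedDistribution_smul (c : ℂ) (f : L2 d) :
    ((c • f : L2 d) : 𝓢'(Eucl d, ℂ)) = c • (f : 𝓢'(Eucl d, ℂ)) :=
  map_smul (Lp.toTemperedDistributionCLM ℂ (volume : Measure (Eucl d)) 2) c f

namespace IsSchrodingerPath

variable {τ : ℝ} {κ₁ κ₂ : ℝ → ℝ} {w w₁ w₂ : ℝ → L2 d}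

theorem norm_eq (h : IsSchrodingerPath τ κ₁ κ₂ w) {t : ℝ} (ht : t ∈ Icc 0 τ) : ‖w t‖ = ‖w 0‖ := by
  obtain ⟨w', h1, h2⟩ := h
  exact norm_eq_of_schrodinger h1 h2 ht

theorem continuousOn (h : IsSchrodingerPath τ κ₁ κ₂ w) : ContinuousOn w (Icc 0 τ) := by
  obtain ⟨w', h1, h2⟩ := h
  exact fun t ht => (h1 t ht).continuousWithinAt

theorem add (h₁ : IsSchrodingerPath τ κ₁ κ₂ w₁) (h₂ : IsSchrodingerPath τ κ₁ κ₂ w₂) :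
    IsSchrodingerPath τ κ₁ κ₂ (fun t => w₁ t + w₂ t) := by
  obtain ⟨w₁', hd₁, he₁⟩ := h₁
  obtain ⟨w₂', hd₂, he₂⟩ := h₂
  refine ⟨fun t => w₁' t + w₂' t, fun t ht => (hd₁ t ht).add (hd₂ t ht), fun t ht => ?_⟩
  obtain ⟨g₁, h₁, hg₁, hh₁, e₁⟩ := he₁ t ht
  obtain ⟨g₂, h₂, hg₂, hh₂, e₂⟩ := he₂ t ht
  refine ⟨g₁ + g₂, h₁ + h₂, ?_, ?_, ?_⟩
  · rw [Lp.toTemperedDistribution_add, Lp.toTemperedDistribution_add, ← hg₁, ← hg₂,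
      ← laplacianCLM_apply, map_add]
    simp only [laplacianCLM_apply]
  · rw [Lp.toTemperedDistribution_add, Lp.toTemperedDistribution_add, ← hh₁, ← hh₂, map_add]
  · simp only [e₁, e₂, smul_add]
    abel

theorem const_smul (c : ℂ) (h₁ : IsSchrodingerPath τ κ₁ κ₂ w) :
    IsSchrodingerPath τ κ₁ κ₂ (fun t => c • w t) := by
  obtain ⟨w', hd, he⟩ := h₁
  refine ⟨fun t => c • w' t, fun t ht => (hd t ht).const_smul c, fun t ht => ?_⟩
  obtain ⟨g, h, hg, hh, e⟩ := he t ht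
  refine ⟨c • g, c • h, ?_, ?_, ?_⟩
  · rw [Lp.toTemperedDistribution_smul, Lp.toTemperedDistribution_smul, ← hg,
      ← laplacianCLM_apply, map_smul, laplacianCLM_apply]
  · rw [Lp.toTemperedDistribution_smul, Lp.toTemperedDistribution_smul, ← hh, map_smul]
  · simp only [e, smul_sub, smul_comm c]

theorem sub (h₁ : IsSchrodingerPath τ κ₁ κ₂ w₁) (h₂ : IsSchrodingerPath τ κ₁ κ₂ w₂) :
    IsSchrodingerPath τ κ₁ κ₂ (fun t => w₁ t - w₂ t) := by
  simpa [sub_eq_add_neg] using h₁.add (h₂.const_smul (-1))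

theorem zero : IsSchrodingerPath τ κ₁ κ₂ (fun _ => (0 : L2 d)) := by
  refine ⟨fun _ => 0, fun t _ => hasDerivWithinAt_const _ _ _, fun t _ => ⟨0, 0, ?_, ?_, by simp⟩⟩
  · have : ((0 : L2 d) : 𝓢'(Eucl d, ℂ)) = 0 :=
      map_zero (Lp.toTemperedDistributionCLM ℂ (volume : Measure (Eucl d)) 2)
    rw [this, ← laplacianCLM_apply, map_zero]
  · have : ((0 : L2 d) : 𝓢'(Eucl d, ℂ)) = 0 :=
      map_zero (Lp.toTemperedDistributionCLM ℂ (volume : Measure (Eucl d)) 2)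
    rw [this, map_zero]

theorem sum {ι : Type*} (s : Finset ι) (w : ι → ℝ → L2 d)
    (h : ∀ i ∈ s, IsSchrodingerPath τ κ₁ κ₂ (w i)) :
    IsSchrodingerPath τ κ₁ κ₂ (fun t => ∑ i ∈ s, w i t) := by
  classical
  induction s using Finset.induction_on with
  | empty => simpa using zero
  | insert i s hi ih =>
    simp only [Finset.sum_insert hi]
    exact (h i (by simp)).add (ih fun j hj => h j (by simp [hj]))

end IsSchrodingerPath

/-- Membership in `B` gives `∂ᵢ²u` and `xᵢ²u` in `L²`; summing over `i` puts `Δu` and `|x|²u` in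
`L²`. The distributional equation then holds in `L²` by injectivity of the embedding. -/
theorem IsBValuedSolution.isSchrodingerPath {T τ : ℝ} (hτ : τ ≤ T) {κ₁ κ₂ : ℝ → ℝ} {u₀ : L2 d}
    {u : ℝ → L2 d} (hu : IsBValuedSolution T κ₁ κ₂ u₀ u) : IsSchrodingerPath τ κ₁ κ₂ u := by
  obtain ⟨u', -, hd, he⟩ := hu.contDiff_and_equation
  refine ⟨u', fun t ht => (hd t ⟨ht.1, ht.2.trans hτ⟩).mono (Icc_subset_Icc_right hτ),
    fun t ht => ?_⟩
  have hB := hu.continuousOnB.1 t ⟨ht.1.le, ht.2.le.trans hτ⟩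
  have hΔ : ∃ g : L2 d, Δ (u t : 𝓢'(Eucl d, ℂ)) = (g : 𝓢'(Eucl d, ℂ)) := by
    have h1 : ∀ i : Fin d, ∃ g : L2 d, ∂_{EuclideanSpace.single i (1 : ℝ)}
        (∂_{EuclideanSpace.single i (1 : ℝ)} (u t : 𝓢'(Eucl d, ℂ))) = (g : 𝓢'(Eucl d, ℂ)) := by
      intro i
      obtain ⟨g, hg⟩ := hB 0 2 Fin.elim0 (fun _ => i) (by norm_num)
      refine ⟨g, ?_⟩
      rw [← hg, weightedDeriv]
      simp [LineDeriv.iteratedLineDerivOp_const_eq_iter_lineDerivOp]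
    choose g hg using h1
    refine ⟨∑ i, g i, ?_⟩
    rw [laplacian_eq_sum (EuclideanSpace.basisFun (Fin d) ℝ)]
    simp only [EuclideanSpace.basisFun_apply, hg]
    exact (map_sum (Lp.toTemperedDistributionCLM ℂ (volume : Measure (Eucl d)) 2) g _).symm
  have hX : ∃ h : L2 d, smulLeftCLM ℂ (fun x : Eucl d => ((‖x‖ ^ 2 : ℝ) : ℂ))
      (u t : 𝓢'(Eucl d, ℂ)) = (h : 𝓢'(Eucl d, ℂ)) := by
    have h1 : ∀ i : Fin d, ∃ g : L2 d, smulLeftCLM ℂ (fun x : Eucl d => ((x i : ℝ) : ℂ) ^ 2)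
        (u t : 𝓢'(Eucl d, ℂ)) = (g : 𝓢'(Eucl d, ℂ)) := by
      intro i
      obtain ⟨g, hg⟩ := hB 2 0 (fun _ => i) Fin.elim0 (by norm_num)
      refine ⟨g, ?_⟩
      rw [← hg, weightedDeriv]
      simp
    choose g hg using h1
    refine ⟨∑ i, g i, ?_⟩
    have e : (fun x : Eucl d => ((‖x‖ ^ 2 : ℝ) : ℂ)) =
        fun x => ∑ i, ((x i : ℝ) : ℂ) ^ 2 := by
      ext x
      rw [EuclideanSpace.real_norm_sq_eq]
      push_cast
      rfl
    rw [e, smulLeftCLM_sum]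
    · simp only [sum_apply, hg]
      exact (map_sum (Lp.toTemperedDistributionCLM ℂ (volume : Measure (Eucl d)) 2) g _).symm
    · intro i _
      have h1 : (fun x : Eucl d => ((x i : ℝ) : ℂ)).HasTemperateGrowth :=
        (Complex.ofRealCLM ∘L (EuclideanSpace.proj (𝕜 := ℝ) i)).hasTemperateGrowth
      simp only [pow_two]
      exact h1.mul h1
  obtain ⟨g, hg⟩ := hΔ
  obtain ⟨h, hh⟩ := hX
  refine ⟨g, h, hg, hh, ?_⟩
  have e := he t ⟨ht.1, ht.2.le.trans hτ⟩
  apply Lp.toTemperedDistribution_injective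
  rw [oscillator, hg, hh] at e
  have e' : (Complex.I * κ₁ t) • g - (Complex.I * κ₂ t) • h =
      (Complex.I * κ₁ t) • g + (-(Complex.I * κ₂ t)) • h := by rw [neg_smul, sub_eq_add_neg]
  rw [eq_neg_of_add_eq_zero_left e, e', Lp.toTemperedDistribution_add,
    Lp.toTemperedDistribution_smul, Lp.toTemperedDistribution_smul, smul_add, smul_neg, smul_smul,
    smul_smul, neg_add, neg_neg, neg_smul]

/-! ### Complex Gaussians as solutions. -/

/-- The complex Gaussian `ρ exp(-α|x|² - 2β a·x - γ|a|²)`. -/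
def gaussWave (α β γ ρ : ℂ) (a x : Eucl d) : ℂ :=
  ρ * Complex.exp (-(α * (‖x‖ ^ 2 : ℝ)) - 2 * β * (inner ℝ a x : ℝ) - γ * (‖a‖ ^ 2 : ℝ))

theorem continuous_gaussWave (α β γ ρ : ℂ) (a : Eucl d) : Continuous (gaussWave α β γ ρ a) := by
  unfold gaussWave
  fun_prop

theorem norm_gaussWave (α β γ ρ : ℂ) (a x : Eucl d) : ‖gaussWave α β γ ρ a x‖ =
    ‖ρ‖ * Real.exp (-(α.re * ‖x‖ ^ 2) - 2 * β.re * inner ℝ a x - γ.re * ‖a‖ ^ 2) := by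
  rw [gaussWave, norm_mul, Complex.norm_exp]
  congr 2
  simp [-Complex.ofReal_pow]

/-- The constant is uniform in the four parameters, as a domination along a whole time interval
requires. The factor `1 + ‖x‖²` pays for the growth of the Laplacian factor and of the potential. -/
theorem exists_gaussWave_le {c : ℝ} (hc : 0 < c) (B : ℝ) (a : Eucl d) :
    ∃ K, 0 ≤ K ∧ ∀ α β γ ρ : ℂ, c ≤ α.re → ‖β‖ ≤ B → ‖γ‖ ≤ B → ‖ρ‖ ≤ B → ∀ x,
      (1 + ‖x‖ ^ 2) * ‖gaussWave α β γ ρ a x‖ ≤ K * Real.exp (-(c / 4) * ‖x‖ ^ 2) := by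
  obtain ⟨K, hK, h⟩ := exists_poly_mul_exp_le hc (2 * |B| * ‖a‖)
  refine ⟨|B| * Real.exp (|B| * ‖a‖ ^ 2) * K, by positivity, ?_⟩
  intro α β γ ρ hα hβ hγ hρ x
  have hB : B ≤ |B| := le_abs_self B
  have h1 : -(α.re * ‖x‖ ^ 2) ≤ -c * ‖x‖ ^ 2 := by nlinarith [sq_nonneg ‖x‖]
  have h2 : -(2 * β.re * inner ℝ a x) ≤ 2 * |B| * ‖a‖ * ‖x‖ := by
    have h3 : |β.re * inner ℝ a x| ≤ |B| * (‖a‖ * ‖x‖) := by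
      rw [abs_mul]
      exact mul_le_mul ((Complex.abs_re_le_norm β).trans (hβ.trans hB)) (abs_real_inner_le_norm a x)
        (abs_nonneg _) (abs_nonneg _)
    have := neg_abs_le (β.re * inner ℝ a x)
    nlinarith
  have h3 : -(γ.re * ‖a‖ ^ 2) ≤ |B| * ‖a‖ ^ 2 := by
    have : -γ.re ≤ |B| := by
      have := (abs_le.1 ((Complex.abs_re_le_norm γ).trans (hγ.trans hB))).1
      linarith
    nlinarith [sq_nonneg ‖a‖]
  rw [norm_gaussWave]
  calc _ ≤ (1 + ‖x‖ ^ 2) * (|B| * Real.exp ((-c * ‖x‖ ^ 2 + 2 * |B| * ‖a‖ * ‖x‖) +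
        |B| * ‖a‖ ^ 2)) := by
        gcongr
        · exact hρ.trans hB
        · linarith
    _ = |B| * Real.exp (|B| * ‖a‖ ^ 2) *
        ((1 + ‖x‖ ^ 2) * Real.exp (-c * ‖x‖ ^ 2 + 2 * |B| * ‖a‖ * ‖x‖)) := by
      rw [Real.exp_add]
      ring
    _ ≤ |B| * Real.exp (|B| * ‖a‖ ^ 2) * (K * Real.exp (-(c / 4) * ‖x‖ ^ 2)) := by
      exact mul_le_mul_of_nonneg_left (h ‖x‖) (by positivity)
    _ = _ := by ring

/-- Continuous multiples of a Gaussian by a function of quadratic growth. -/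
theorem exists_mul_gaussWave_le {α : ℂ} (hα : 0 < α.re) (β γ ρ : ℂ) (a : Eucl d) {P : Eucl d → ℂ}
    {M : ℝ} (hP : ∀ x, ‖P x‖ ≤ M * (1 + ‖x‖ ^ 2)) :
    ∃ K, ∀ x, ‖P x * gaussWave α β γ ρ a x‖ ≤ K * Real.exp (-(α.re / 4) * ‖x‖ ^ 2) := by
  obtain ⟨K, hK, h⟩ := exists_gaussWave_le hα (‖β‖ + ‖γ‖ + ‖ρ‖) a
  have hM : 0 ≤ M := by
    have h0 := (norm_nonneg _).trans (hP 0)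
    simpa using h0
  refine ⟨M * K, fun x => ?_⟩
  rw [norm_mul]
  have hβ := norm_nonneg β
  have hγ := norm_nonneg γ
  have hρ := norm_nonneg ρ
  calc _ ≤ M * (1 + ‖x‖ ^ 2) * ‖gaussWave α β γ ρ a x‖ := by gcongr; exact hP x
    _ = M * ((1 + ‖x‖ ^ 2) * ‖gaussWave α β γ ρ a x‖) := by ring
    _ ≤ M * (K * Real.exp (-(α.re / 4) * ‖x‖ ^ 2)) := by
      exact mul_le_mul_of_nonneg_left
        (h α β γ ρ le_rfl (by linarith) (by linarith) (by linarith) x) hM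
    _ = _ := by ring

theorem hasLineDerivAt_gaussWave (α β γ ρ : ℂ) (a x : Eucl d) (i : Fin d) :
    HasLineDerivAt ℝ (gaussWave α β γ ρ a)
      (-(2 * α * x i + 2 * β * a i) * gaussWave α β γ ρ a x) x (EuclideanSpace.single i 1) := by
  unfold HasLineDerivAt gaussWave
  have e (t : ℝ) : ‖x + t • EuclideanSpace.single i (1 : ℝ)‖ ^ 2 =
      ‖x‖ ^ 2 + 2 * t * x i + t ^ 2 := by
    rw [norm_add_sq_real, norm_smul, inner_smul_right, EuclideanSpace.inner_single_right]
    simp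
    ring
  have e2 (t : ℝ) : inner ℝ a (x + t • EuclideanSpace.single i (1 : ℝ)) =
      inner ℝ a x + t * a i := by
    rw [inner_add_right, inner_smul_right, EuclideanSpace.inner_single_right]
    simp
  simp only [e, e2]
  have h1 : HasDerivAt (fun t : ℝ => -(α * ((‖x‖ ^ 2 + 2 * t * x i + t ^ 2 : ℝ) : ℂ)) -
      2 * β * ((inner ℝ a x + t * a i : ℝ) : ℂ) - γ * ((‖a‖ ^ 2 : ℝ) : ℂ))
      (-(2 * α * x i + 2 * β * a i)) 0 := by
    have h2 : HasDerivAt (fun t : ℝ => ‖x‖ ^ 2 + 2 * t * x i + t ^ 2) (2 * x i) 0 := by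
      have := ((((hasDerivAt_id (0 : ℝ)).const_mul 2).mul_const (x i)).const_add (‖x‖ ^ 2)).add
        ((hasDerivAt_id (0 : ℝ)).pow 2)
      exact this.congr_deriv (by simp)
    have h3 : HasDerivAt (fun t : ℝ => inner ℝ a x + t * a i) (a i) 0 := by
      simpa using ((hasDerivAt_id (0 : ℝ)).mul_const (a i)).const_add (inner ℝ a x)
    have := (((h2.ofReal_comp.const_mul α).neg).sub (h3.ofReal_comp.const_mul (2 * β))).sub_const
      (γ * ((‖a‖ ^ 2 : ℝ) : ℂ))
    refine this.congr_deriv ?_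
    push_cast
    ring
  refine ((h1.cexp).const_mul ρ).congr_deriv ?_
  simp
  ring

theorem hasLineDerivAt_gaussWave_second (α β γ ρ : ℂ) (a x : Eucl d) (i : Fin d) :
    HasLineDerivAt ℝ (fun x => -(2 * α * x i + 2 * β * a i) * gaussWave α β γ ρ a x)
      (((2 * α * x i + 2 * β * a i) ^ 2 - 2 * α) * gaussWave α β γ ρ a x) x
      (EuclideanSpace.single i 1) := by
  have h1 : HasLineDerivAt ℝ (fun x : Eucl d => -(2 * α * x i + 2 * β * a i)) (-(2 * α)) x
      (EuclideanSpace.single i 1) := by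
    unfold HasLineDerivAt
    have h3 : HasDerivAt (fun t : ℝ => x i + t) 1 0 := (hasDerivAt_id (0 : ℝ)).const_add (x i)
    have := ((h3.ofReal_comp.const_mul (2 * α)).add_const (2 * β * a i)).neg
    simp only [PiLp.add_apply, PiLp.smul_apply, PiLp.single_apply, if_true, smul_eq_mul, mul_one]
    exact this.congr_deriv (by simp)
  have h2 := hasLineDerivAt_gaussWave α β γ ρ a x i
  refine (HasDerivAt.mul h1 h2).congr_deriv ?_
  simp only [zero_smul, add_zero]
  ring

/-- The polynomial factor in the Laplacian of a complex Gaussian. -/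
def gaussLaplacianFactor (α β : ℂ) (a x : Eucl d) : ℂ :=
  4 * α ^ 2 * (‖x‖ ^ 2 : ℝ) + 8 * α * β * (inner ℝ a x : ℝ) + 4 * β ^ 2 * (‖a‖ ^ 2 : ℝ) - 2 * d * α

theorem continuous_gaussLaplacianFactor (α β : ℂ) (a : Eucl d) :
    Continuous (gaussLaplacianFactor α β a) := by
  unfold gaussLaplacianFactor
  fun_prop

theorem norm_gaussLaplacianFactor_le {α β : ℂ} {B : ℝ} (hα : ‖α‖ ≤ B) (hβ : ‖β‖ ≤ B)
    (a x : Eucl d) : ‖gaussLaplacianFactor α β a x‖ ≤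
      (4 * B ^ 2 + 8 * B ^ 2 * ‖a‖ + 4 * B ^ 2 * ‖a‖ ^ 2 + 2 * d * B) * (1 + ‖x‖ ^ 2) := by
  have hB : 0 ≤ B := (norm_nonneg α).trans hα
  have h1 : ‖4 * α ^ 2 * ((‖x‖ ^ 2 : ℝ) : ℂ)‖ ≤ 4 * B ^ 2 * (1 + ‖x‖ ^ 2) := by
    rw [norm_mul, norm_mul, norm_pow, Complex.norm_real, Real.norm_of_nonneg (by positivity)]
    norm_num
    gcongr
    linarith
  have h2 : ‖8 * α * β * ((inner ℝ a x : ℝ) : ℂ)‖ ≤ 8 * B ^ 2 * ‖a‖ * (1 + ‖x‖ ^ 2) := by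
    rw [norm_mul, norm_mul, norm_mul, Complex.norm_real]
    norm_num
    calc _ ≤ 8 * B * B * (‖a‖ * ‖x‖) := by
          gcongr
          exact abs_real_inner_le_norm a x
      _ = 8 * B ^ 2 * ‖a‖ * ‖x‖ := by ring
      _ ≤ _ := by
        gcongr
        nlinarith [sq_nonneg (‖x‖ - 1), norm_nonneg x]
  have h3 : ‖4 * β ^ 2 * ((‖a‖ ^ 2 : ℝ) : ℂ)‖ ≤ 4 * B ^ 2 * ‖a‖ ^ 2 * (1 + ‖x‖ ^ 2) := by
    rw [norm_mul, norm_mul, norm_pow, Complex.norm_real, Real.norm_of_nonneg (by positivity)]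
    norm_num
    calc 4 * ‖β‖ ^ 2 * ‖a‖ ^ 2 ≤ 4 * B ^ 2 * ‖a‖ ^ 2 * 1 := by rw [mul_one]; gcongr
      _ ≤ _ := by
        gcongr
        nlinarith [sq_nonneg ‖x‖]
  have h4 : ‖2 * d * α‖ ≤ 2 * d * B * (1 + ‖x‖ ^ 2) := by
    rw [norm_mul, norm_mul, Complex.norm_natCast]
    norm_num
    calc 2 * d * ‖α‖ ≤ 2 * d * B * 1 := by rw [mul_one]; gcongr
      _ ≤ _ := by
        gcongr
        nlinarith [sq_nonneg ‖x‖]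
  calc _ ≤ _ := norm_sub_le _ _
    _ ≤ _ := add_le_add_left ((norm_add_le _ _).trans (add_le_add_left (norm_add_le _ _) _)) _
    _ ≤ _ := by linarith

theorem laplacian_gaussWave {α β γ ρ : ℂ} (hα : 0 < α.re) {a : Eucl d} {v g : L2 d}
    (hv : v =ᵐ[volume] gaussWave α β γ ρ a)
    (hg : g =ᵐ[volume] fun x => gaussLaplacianFactor α β a x * gaussWave α β γ ρ a x) :
    Δ (v : 𝓢'(Eucl d, ℂ)) = (g : 𝓢'(Eucl d, ℂ)) := by
  have hint {P : Eucl d → ℂ} (hPc : Continuous P) {M : ℝ} (hP : ∀ x, ‖P x‖ ≤ M * (1 + ‖x‖ ^ 2)) :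
      Integrable fun x => P x * gaussWave α β γ ρ a x := by
    obtain ⟨K, hK⟩ := exists_mul_gaussWave_le hα β γ ρ a hP
    exact integrable_of_le_exp (hPc.mul (continuous_gaussWave _ _ _ _ _)) (by positivity) hK
  have hlin (i : Fin d) (x : Eucl d) :
      ‖2 * α * x i + 2 * β * a i‖ ≤ 2 * ‖α‖ * ‖x‖ + 2 * ‖β‖ * ‖a‖ := by
    refine (norm_add_le _ _).trans (add_le_add ?_ ?_)
    · rw [norm_mul, norm_mul, Complex.norm_real]
      norm_num
      gcongr
      exact PiLp.norm_apply_le x i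
    · rw [norm_mul, norm_mul, Complex.norm_real]
      norm_num
      gcongr
      exact PiLp.norm_apply_le a i
  have hx (x : Eucl d) : ‖x‖ ≤ 1 + ‖x‖ ^ 2 := by nlinarith [sq_nonneg (‖x‖ - 1), norm_nonneg x]
  refine laplacian_eq_of_hasLineDerivAt (f := gaussWave α β γ ρ a) ?_ ?_ ?_
    (fun i x => hasLineDerivAt_gaussWave α β γ ρ a x i)
    (fun i x => hasLineDerivAt_gaussWave_second α β γ ρ a x i) hv (hg.trans ?_)
  · simpa using hint (P := fun _ => 1) continuous_const (M := 1) (fun x => by simp)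
  · intro i
    refine hint (by fun_prop) (M := 2 * ‖α‖ + 2 * ‖β‖ * ‖a‖) fun x => ?_
    rw [norm_neg]
    have h1 := mul_le_mul_of_nonneg_left (hx x) (show 0 ≤ 2 * ‖α‖ by positivity)
    have h2 : 0 ≤ 2 * ‖β‖ * ‖a‖ * ‖x‖ ^ 2 := by positivity
    linarith [hlin i x]
  · intro i
    refine hint (by fun_prop) (M := 8 * ‖α‖ ^ 2 + 8 * ‖β‖ ^ 2 * ‖a‖ ^ 2 + 2 * ‖α‖) fun x => ?_
    have h1 : ‖(2 * α * x i + 2 * β * a i) ^ 2‖ ≤ (2 * ‖α‖ * ‖x‖ + 2 * ‖β‖ * ‖a‖) ^ 2 := by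
      rw [norm_pow]
      gcongr
      exact hlin i x
    have h2 : ‖2 * α‖ = 2 * ‖α‖ := by simp
    have h3 := norm_sub_le ((2 * α * x i + 2 * β * a i) ^ 2) (2 * α)
    have h4 : 0 ≤ 8 * ‖α‖ ^ 2 := by positivity
    have h5 : 0 ≤ 8 * ‖β‖ ^ 2 * ‖a‖ ^ 2 * ‖x‖ ^ 2 := by positivity
    have h6 : 0 ≤ 2 * ‖α‖ * ‖x‖ ^ 2 := by positivity
    nlinarith [sq_nonneg (2 * ‖α‖ * ‖x‖ - 2 * ‖β‖ * ‖a‖)]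
  · refine Eventually.of_forall fun x => ?_
    simp only
    rw [← Finset.sum_mul]
    congr 1
    simp only [gaussLaplacianFactor, EuclideanSpace.real_norm_sq_eq, PiLp.inner_apply]
    push_cast
    simp only [Finset.mul_sum, Finset.sum_sub_distrib, ← Finset.sum_add_distrib, Finset.sum_const]
    rw [Finset.card_univ, Fintype.card_fin, nsmul_eq_mul]
    congr 1
    · refine Finset.sum_congr rfl fun i _ => ?_
      simp
      ring
    · ring

/-- The four ODEs come from matching the coefficients of `|x|²`, `a·x`, `|a|²` and `1` after
division by the Gaussian. Uniform bounds on the compact interval provide the domination for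
`hasDerivWithinAt_L2_of_dominated`. -/
theorem exists_isSchrodingerPath_gaussWave {τ : ℝ} {κ₁ κ₂ : ℝ → ℝ}
    (hκ₁ : ContinuousOn κ₁ (Icc 0 τ)) (hκ₂ : ContinuousOn κ₂ (Icc 0 τ)) {α β γ ρ : ℝ → ℂ} {c : ℝ}
    (hc : 0 < c) (hα : ∀ t ∈ Icc 0 τ, c ≤ (α t).re)
    (dα : ∀ t ∈ Icc 0 τ, HasDerivWithinAt α
      (-4 * Complex.I * κ₁ t * α t ^ 2 + Complex.I * κ₂ t) (Icc 0 τ) t)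
    (dβ : ∀ t ∈ Icc 0 τ, HasDerivWithinAt β (-4 * Complex.I * κ₁ t * α t * β t) (Icc 0 τ) t)
    (dγ : ∀ t ∈ Icc 0 τ, HasDerivWithinAt γ (-4 * Complex.I * κ₁ t * β t ^ 2) (Icc 0 τ) t)
    (dρ : ∀ t ∈ Icc 0 τ, HasDerivWithinAt ρ (-2 * Complex.I * d * κ₁ t * α t * ρ t) (Icc 0 τ) t)
    (a : Eucl d) :
    ∃ v : ℝ → L2 d, IsSchrodingerPath τ κ₁ κ₂ v ∧
      ∀ t ∈ Icc 0 τ, v t =ᵐ[volume] gaussWave (α t) (β t) (γ t) (ρ t) a := by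
  -- Decay is known only for times in `[0,τ]`; elsewhere the class is set to 0.
  have hmem {P : Eucl d → ℂ} (hPc : Continuous P) {M : ℝ} (hP : ∀ x, ‖P x‖ ≤ M * (1 + ‖x‖ ^ 2))
      (t : ℝ) : ∃ w : L2 d, t ∈ Icc 0 τ →
        w =ᵐ[volume] fun x => P x * gaussWave (α t) (β t) (γ t) (ρ t) a x := by
    by_cases ht : t ∈ Icc 0 τ
    · have hαt := hc.trans_le (hα t ht)
      obtain ⟨K, hK⟩ := exists_mul_gaussWave_le hαt (β t) (γ t) (ρ t) a hP
      have := memLp_two_of_le_exp (hPc.mul (continuous_gaussWave (α t) (β t) (γ t) (ρ t) a))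
        (by positivity) hK
      exact ⟨this.toLp, fun _ => this.coeFn_toLp⟩
    · exact ⟨0, fun h => absurd h ht⟩
  choose v hv using fun t => hmem (P := fun _ => 1) continuous_const (M := 1) (fun x => by simp) t
  choose g hg using fun t => hmem (continuous_gaussLaplacianFactor (α t) (β t) a)
    (norm_gaussLaplacianFactor_le (le_max_left _ ‖β t‖) (le_max_right ‖α t‖ _) a) t
  choose h hh using fun t => hmem (P := fun x => ((‖x‖ ^ 2 : ℝ) : ℂ)) (by fun_prop) (M := 1)
    (fun x => by simp) t
  simp only [one_mul] at hv
  refine ⟨v, ⟨fun t => (Complex.I * κ₁ t) • g t - (Complex.I * κ₂ t) • h t, ?_, ?_⟩, hv⟩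
  · have bound {E : Type} [NormedAddCommGroup E] {f : ℝ → E} (hf : ContinuousOn f (Icc 0 τ)) :
        ∃ C, ∀ t ∈ Icc 0 τ, ‖f t‖ ≤ C := isCompact_Icc.exists_bound_of_continuousOn hf
    obtain ⟨B₁, hB₁⟩ := bound hκ₁
    obtain ⟨B₂, hB₂⟩ := bound hκ₂
    obtain ⟨B₃, hB₃⟩ := bound (f := α) fun t ht => (dα t ht).continuousWithinAt
    obtain ⟨B₄, hB₄⟩ := bound (f := β) fun t ht => (dβ t ht).continuousWithinAt
    obtain ⟨B₅, hB₅⟩ := bound (f := γ) fun t ht => (dγ t ht).continuousWithinAt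
    obtain ⟨B₆, hB₆⟩ := bound (f := ρ) fun t ht => (dρ t ht).continuousWithinAt
    obtain ⟨B, b₁, b₂, b₃, b₄, b₅, b₆⟩ : ∃ B, B₁ ≤ B ∧ B₂ ≤ B ∧ B₃ ≤ B ∧ B₄ ≤ B ∧ B₅ ≤ B ∧ B₆ ≤ B :=
      ⟨max B₁ (max B₂ (max B₃ (max B₄ (max B₅ B₆)))), by simp⟩
    obtain ⟨K, hK, hle⟩ := exists_gaussWave_le hc B a
    set M := 4 * B ^ 2 + 8 * B ^ 2 * ‖a‖ + 4 * B ^ 2 * ‖a‖ ^ 2 + 2 * d * B with hM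
    intro t ht
    refine hasDerivWithinAt_L2_of_dominated (convex_Icc 0 τ)
      (v' := fun t => (Complex.I * κ₁ t) • g t - (Complex.I * κ₂ t) • h t)
      (F := fun t x => gaussWave (α t) (β t) (γ t) (ρ t) a x)
      (F' := fun t x => (Complex.I * κ₁ t * gaussLaplacianFactor (α t) (β t) a x -
        Complex.I * κ₂ t * (‖x‖ ^ 2 : ℝ)) * gaussWave (α t) (β t) (γ t) (ρ t) a x)
      (g := fun x => ((B * M + B) * K) * Real.exp (-(c / 4) * ‖x‖ ^ 2))
      ((memLp_exp_neg_mul_sq (by positivity)).const_mul _) hv ?_ ?_ ?_ ht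
    · intro s hs
      filter_upwards [hg s hs, hh s hs,
        Lp.coeFn_sub ((Complex.I * κ₁ s) • g s) ((Complex.I * κ₂ s) • h s),
        Lp.coeFn_smul (Complex.I * κ₁ s : ℂ) (g s), Lp.coeFn_smul (Complex.I * κ₂ s : ℂ) (h s)]
        with x h1 h2 h3 h4 h5
      rw [h3, Pi.sub_apply, h4, h5, Pi.smul_apply, Pi.smul_apply, h1, h2]
      simp only [smul_eq_mul]
      ring
    · intro s hs x
      have h1 := ((((dα s hs).mul_const ((‖x‖ ^ 2 : ℝ) : ℂ)).neg.sub
        (((dβ s hs).const_mul 2).mul_const ((inner ℝ a x : ℝ) : ℂ))).sub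
        ((dγ s hs).mul_const ((‖a‖ ^ 2 : ℝ) : ℂ))).cexp
      refine ((dρ s hs).mul h1).congr_deriv ?_
      simp only [gaussWave, gaussLaplacianFactor]
      simp
      ring
    · intro s hs x
      have c₁ := (hB₁ s hs).trans b₁
      have c₂ := (hB₂ s hs).trans b₂
      have hB : 0 ≤ B := (norm_nonneg _).trans c₁
      have e1 : ‖Complex.I * κ₁ s * gaussLaplacianFactor (α s) (β s) a x -
          Complex.I * κ₂ s * (‖x‖ ^ 2 : ℝ)‖ ≤ (B * M + B) * (1 + ‖x‖ ^ 2) := by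
        refine (norm_sub_le _ _).trans ?_
        rw [norm_mul, norm_mul, norm_mul, norm_mul, Complex.norm_I, Complex.norm_real,
          Complex.norm_real, Complex.norm_real, one_mul, one_mul,
          Real.norm_of_nonneg (sq_nonneg ‖x‖), add_mul, mul_assoc]
        have := norm_gaussLaplacianFactor_le ((hB₃ s hs).trans b₃) ((hB₄ s hs).trans b₄) a x
        gcongr
        linarith
      rw [norm_mul]
      have hM0 : 0 ≤ M := by positivity
      calc _ ≤ (B * M + B) * (1 + ‖x‖ ^ 2) * ‖gaussWave (α s) (β s) (γ s) (ρ s) a x‖ := by gcongr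
        _ = (B * M + B) * ((1 + ‖x‖ ^ 2) * ‖gaussWave (α s) (β s) (γ s) (ρ s) a x‖) := by ring
        _ ≤ (B * M + B) * (K * Real.exp (-(c / 4) * ‖x‖ ^ 2)) :=
          mul_le_mul_of_nonneg_left (hle _ _ _ _ (hα s hs) ((hB₄ s hs).trans b₄)
            ((hB₅ s hs).trans b₅) ((hB₆ s hs).trans b₆) x) (by positivity)
        _ = _ := by ring
  · intro t ht
    have ht' := Ioo_subset_Icc_self ht
    exact ⟨g t, h t, laplacian_gaussWave (hc.trans_le (hα t ht')) (hv t ht') (hg t ht'),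
      smulLeftCLM_eq_of_ae_eq_mul (by fun_prop) <| by
        filter_upwards [hv t ht', hh t ht'] with x h1 h2
        rw [h1, h2], rfl⟩

/-! ### Gaussian solutions through the Riccati system; short-time control. -/

theorem IsRiccatiSolution.mono {T τ : ℝ} (hτ : τ ≤ T) {κ₁ κ₂ y₁ y₂ y₃ : ℝ → ℝ}
    (h : IsRiccatiSolution T κ₁ κ₂ y₁ y₂ y₃) : IsRiccatiSolution τ κ₁ κ₂ y₁ y₂ y₃ where
  deriv₁ t ht := (h.deriv₁ t ⟨ht.1, ht.2.trans hτ⟩).mono (Icc_subset_Icc_right hτ)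
  deriv₂ t ht := (h.deriv₂ t ⟨ht.1, ht.2.trans hτ⟩).mono (Icc_subset_Icc_right hτ)
  deriv₃ t ht := (h.deriv₃ t ⟨ht.1, ht.2.trans hτ⟩).mono (Icc_subset_Icc_right hτ)
  init₁ := h.init₁
  init₂ := h.init₂
  init₃ := h.init₃

/-- The Gaussian solutions of the Schrödinger equation, in terms of the Riccati system. -/
theorem IsRiccatiSolution.exists_gaussian_path {τ : ℝ} (hτ : 0 ≤ τ) {κ₁ κ₂ y₁ y₂ y₃ : ℝ → ℝ}
    (hy : IsRiccatiSolution τ κ₁ κ₂ y₁ y₂ y₃)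
    (hκ₁ : ContinuousOn κ₁ (Icc 0 τ)) (hκ₂ : ContinuousOn κ₂ (Icc 0 τ))
    (hy₂ : ∀ t ∈ Icc 0 τ, 1 / 2 ≤ y₂ t) (hy₃ : ∀ t ∈ Icc 0 τ, |y₃ t| ≤ 1) (a : Eucl d) :
    ∃ v : ℝ → L2 d, IsSchrodingerPath τ κ₁ κ₂ v ∧
      (v 0 =ᵐ[volume] fun x => ((Real.exp (-‖x + a‖ ^ 2) : ℝ) : ℂ)) ∧
      ∀ t ∈ Icc 0 τ, ∀ᵐ x, ‖v t x‖ =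
        (y₂ t ^ 2 * (1 + 16 * y₃ t ^ 2)⁻¹) ^ (d / 4 : ℝ) *
          Real.exp (-((1 + 16 * y₃ t ^ 2)⁻¹ * ‖y₂ t • x + a‖ ^ 2)) := by
  -- The equation for `y₃` gives `q' = 4iκ₁y₂²`, so `γ = 1/q` satisfies its ODE with `β = y₂/q`. The
  -- part of `α` carrying `y₁` is imaginary and enters only the phase. At time 0 all four parameters
  -- equal 1.
  set q : ℝ → ℂ := fun t => 1 - 4 * Complex.I * y₃ t with hq
  have hq0 (t : ℝ) : q t ≠ 0 := by
    intro h
    have := congrArg Complex.re h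
    simp [hq] at this
  have hqn (t : ℝ) : Complex.normSq (q t) = 1 + 16 * y₃ t ^ 2 := by
    simp [hq, Complex.normSq_apply]
    ring
  have hμ (t : ℝ) : ((q t)⁻¹).re = (1 + 16 * y₃ t ^ 2)⁻¹ := by
    rw [Complex.inv_re, hqn]
    simp [hq]
  have hre (r t : ℝ) : ((r : ℂ) * (q t)⁻¹).re = r * (1 + 16 * y₃ t ^ 2)⁻¹ := by
    rw [Complex.re_ofReal_mul, hμ]
  set α : ℝ → ℂ := fun t => -(Complex.I * y₁ t) + ((y₂ t ^ 2 : ℝ) : ℂ) * (q t)⁻¹ with hαdef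
  set β : ℝ → ℂ := fun t => (y₂ t : ℂ) * (q t)⁻¹ with hβdef
  set γ : ℝ → ℂ := fun t => (q t)⁻¹ with hγdef
  set ρ : ℝ → ℂ := fun t => β t ^ ((d / 2 : ℝ) : ℂ) with hρdef
  have hαre (t : ℝ) : (α t).re = y₂ t ^ 2 * (1 + 16 * y₃ t ^ 2)⁻¹ := by
    simp only [hαdef, Complex.add_re, hre]
    simp
  -- `1/68 = (1/4)(1/17)`, from `y₂ ≥ 1/2` and `|y₃| ≤ 1`.
  have hαc : ∀ t ∈ Icc 0 τ, (1 / 68 : ℝ) ≤ (α t).re := by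
    intro t ht
    rw [hαre]
    have h1 : (17 : ℝ)⁻¹ ≤ (1 + 16 * y₃ t ^ 2)⁻¹ := by
      apply inv_anti₀ (by positivity)
      have := (sq_le_one_iff_abs_le_one _).2 (hy₃ t ht)
      linarith
    have h2 : (1 / 4 : ℝ) ≤ y₂ t ^ 2 := by nlinarith [hy₂ t ht]
    calc (1 / 68 : ℝ) = 1 / 4 * 17⁻¹ := by norm_num
      _ ≤ _ := by gcongr
  have dγ : ∀ t ∈ Icc 0 τ, HasDerivWithinAt γ (-4 * Complex.I * κ₁ t * β t ^ 2) (Icc 0 τ) t := by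
    intro t ht
    have h1 := (((hy.deriv₃ t ht).ofReal_comp.const_mul (4 * Complex.I)).const_sub 1).inv (hq0 t)
    refine h1.congr_deriv ?_
    change - -(4 * Complex.I * ((-κ₁ t * y₂ t ^ 2 : ℝ) : ℂ)) / q t ^ 2 = _
    simp only [hβdef]
    have := hq0 t
    push_cast
    field_simp
  have dβ : ∀ t ∈ Icc 0 τ,
      HasDerivWithinAt β (-4 * Complex.I * κ₁ t * α t * β t) (Icc 0 τ) t := by
    intro t ht
    refine ((hy.deriv₂ t ht).ofReal_comp.mul (dγ t ht)).congr_deriv ?_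
    simp only [hβdef, hαdef, hγdef]
    push_cast
    linear_combination (-4 * κ₁ t * y₁ t * y₂ t * (q t)⁻¹) * Complex.I_sq
  have dα : ∀ t ∈ Icc 0 τ, HasDerivWithinAt α
      (-4 * Complex.I * κ₁ t * α t ^ 2 + Complex.I * κ₂ t) (Icc 0 τ) t := by
    intro t ht
    refine ((((hy.deriv₁ t ht).ofReal_comp.const_mul Complex.I).neg).add
      (((hy.deriv₂ t ht).pow 2).ofReal_comp.mul (dγ t ht))).congr_deriv ?_
    simp only [hβdef, hαdef, hγdef]
    simp only [Pi.pow_apply]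
    push_cast
    linear_combination (4 * Complex.I * κ₁ t * y₁ t ^ 2 -
      8 * κ₁ t * y₁ t * y₂ t ^ 2 * (q t)⁻¹) * Complex.I_sq
  have hβre (t : ℝ) (ht : t ∈ Icc 0 τ) : 0 < (β t).re := by
    rw [hre]
    have := hy₂ t ht
    positivity
  have dρ : ∀ t ∈ Icc 0 τ,
      HasDerivWithinAt ρ (-2 * Complex.I * d * κ₁ t * α t * ρ t) (Icc 0 τ) t := by
    intro t ht
    -- `ρ = β^(d/2)` works because `β'/β = -4iκ₁α`. Since `Re β > 0`, the principal power is
    -- differentiable there.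
    have hβ0 : β t ≠ 0 := fun h => by simpa [h] using hβre t ht
    have h1 : HasDerivAt (fun z : ℂ => z ^ ((d / 2 : ℝ) : ℂ)) _ (β t) :=
      (hasDerivAt_id (β t)).cpow_const (Or.inl (hβre t ht))
    refine (h1.comp_hasDerivWithinAt t (dβ t ht)).congr_deriv ?_
    simp only [hρdef, id, Complex.cpow_sub _ _ hβ0, Complex.cpow_one]
    field_simp
    push_cast
    ring
  obtain ⟨v, hv, hva⟩ := exists_isSchrodingerPath_gaussWave hκ₁ hκ₂ (by norm_num) hαc dα dβ dγ dρ a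
  refine ⟨v, hv, ?_, fun t ht => ?_⟩
  · filter_upwards [hva 0 ⟨le_rfl, hτ⟩] with x hx
    rw [hx, gaussWave]
    simp only [hαdef, hβdef, hγdef, hρdef, hq, hy.init₁, hy.init₂, hy.init₃, norm_add_sq_real,
      real_inner_comm]
    simp
    ring_nf
  · filter_upwards [hva t ht] with x hx
    rw [hx, norm_gaussWave, hαre, hre]
    congr 1
    · have hn : ‖β t‖ ^ 2 = y₂ t ^ 2 * (1 + 16 * y₃ t ^ 2)⁻¹ := by
        rw [hβdef, norm_mul, mul_pow, norm_inv, inv_pow, ← Complex.normSq_eq_norm_sq (q t), hqn]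
        simp
      rw [← hn, ← Real.rpow_natCast, ← Real.rpow_mul (norm_nonneg _), hρdef]
      simp only [Complex.norm_cpow_real]
      congr 1
      push_cast
      ring
    · congr 1
      -- The real parts of `α`, `β`, `γ` are `μy₂²`, `μy₂`, `μ`, so the real exponent is `-μ` times
      -- the perfect square `|y₂ x + a|²`.
      rw [norm_add_sq_real, norm_smul, inner_smul_left, real_inner_comm, hμ, mul_pow,
        Real.norm_eq_abs, sq_abs]
      simp
      ring

/-- A barrier argument with the line `K t`: as long as it is at most 1, a trajectory touching it has
`|y₁|, |y₃| ≤ 1` and `|y₂| ≤ 2`, hence speed at most `8M₁ + M₂ < K`, and cannot cross. -/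
theorem IsRiccatiSolution.abs_sub_init_le {T : ℝ} {κ₁ κ₂ y₁ y₂ y₃ : ℝ → ℝ}
    (hy : IsRiccatiSolution T κ₁ κ₂ y₁ y₂ y₃) {M₁ M₂ : ℝ} (hM₁ : 0 ≤ M₁) (hM₂ : 0 ≤ M₂)
    (h₁ : ∀ t ∈ Icc 0 T, |κ₁ t| ≤ M₁) (h₂ : ∀ t ∈ Icc 0 T, |κ₂ t| ≤ M₂) {ε : ℝ}
    (hε₁ : ε ≤ 1) {τ : ℝ} (hτT : τ ≤ T) (hτ : (8 * M₁ + M₂ + 1) * τ ≤ ε) {t : ℝ}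
    (ht : t ∈ Icc 0 τ) : |y₁ t| ≤ ε ∧ |y₂ t - 1| ≤ ε ∧ |y₃ t| ≤ ε := by
  set K := 8 * M₁ + M₂ + 1 with hK
  have hK0 : 0 < K := by positivity
  have hy' := hy.mono hτT
  set f : ℝ → ℝ × ℝ × ℝ := fun t => (y₁ t, y₂ t - 1, y₃ t) with hf
  have hd : ∀ s ∈ Icc 0 τ, HasDerivWithinAt f (-4 * κ₁ s * y₁ s ^ 2 - κ₂ s,
      -4 * κ₁ s * y₁ s * y₂ s, -κ₁ s * y₂ s ^ 2) (Icc 0 τ) s := fun s hs =>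
    (hy'.deriv₁ s hs).prodMk (((hy'.deriv₂ s hs).sub_const 1).prodMk (hy'.deriv₃ s hs))
  have key : ‖f t‖ ≤ K * t := by
    refine image_norm_le_of_norm_deriv_right_lt_deriv_boundary' (B := fun s => K * s)
      (B' := fun _ => K) (fun s hs => (hd s hs).continuousWithinAt)
      (fun s hs => (hd s (Ico_subset_Icc_self hs)).mono_of_mem_nhdsWithin ?_)
      ?_ (by fun_prop) ?_ ?_ ht
    · exact mem_of_superset (Ico_mem_nhdsGE hs.2) fun r hr => ⟨hs.1.trans hr.1, hr.2.le⟩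
    · simp [hf, hy.init₁, hy.init₂, hy.init₃]
    · intro s _
      simpa using ((hasDerivAt_id s).const_mul K).hasDerivWithinAt
    · intro s hs he
      have hsT : s ∈ Icc 0 T := ⟨hs.1, hs.2.le.trans hτT⟩
      have hle : ‖f s‖ ≤ 1 := by
        rw [he]
        nlinarith [hs.2]
      simp only [hf, Prod.norm_def, sup_le_iff, Real.norm_eq_abs] at hle
      obtain ⟨b₁, b₂, b₃⟩ := hle
      have b₂' : |y₂ s| ≤ 2 := by
        rw [abs_le] at b₂ ⊢
        constructor <;> linarith
      have k₁ := h₁ s hsT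
      have k₂ := h₂ s hsT
      simp only [Prod.norm_def, sup_lt_iff, Real.norm_eq_abs]
      refine ⟨?_, ?_, ?_⟩
      · calc |-4 * κ₁ s * y₁ s ^ 2 - κ₂ s| ≤ |-4 * κ₁ s * y₁ s ^ 2| + |κ₂ s| := abs_sub _ _
          _ = 4 * |κ₁ s| * |y₁ s| ^ 2 + |κ₂ s| := by
            rw [abs_mul, abs_mul, abs_pow]
            norm_num
          _ ≤ 4 * M₁ * 1 ^ 2 + M₂ := by gcongr
          _ < K := by linarith
      · calc |-4 * κ₁ s * y₁ s * y₂ s| = 4 * |κ₁ s| * |y₁ s| * |y₂ s| := by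
              rw [abs_mul, abs_mul, abs_mul]
              norm_num
          _ ≤ 4 * M₁ * 1 * 2 := by gcongr
          _ < K := by linarith
      · calc |-κ₁ s * y₂ s ^ 2| = |κ₁ s| * |y₂ s| ^ 2 := by
              rw [abs_mul, abs_pow, abs_neg]
          _ ≤ M₁ * 2 ^ 2 := by gcongr
          _ < K := by linarith
  have hle : ‖f t‖ ≤ ε := key.trans ((mul_le_mul_of_nonneg_left ht.2 hK0.le).trans hτ)
  simp only [hf, Prod.norm_def, sup_le_iff, Real.norm_eq_abs] at hle
  exact hle

/-! ### Mass and pair interactions of Gaussians in a ball. -/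

theorem integral_exp_neg_mul_norm_add_sq {s : ℝ} (hs : 0 < s) (b : Eucl d) :
    ∫ x : Eucl d, Real.exp (-s * ‖x + b‖ ^ 2) = (Real.pi / s) ^ (d / 2 : ℝ) := by
  rw [integral_add_right_eq_self (fun x : Eucl d => Real.exp (-s * ‖x‖ ^ 2)) b,
    GaussianFourier.integral_rexp_neg_mul_sq_norm hs]
  simp

theorem integrable_exp_neg_mul_norm_add_sq {s : ℝ} (hs : 0 < s) (b : Eucl d) :
    Integrable fun x : Eucl d => Real.exp (-s * ‖x + b‖ ^ 2) :=
  (integrable_exp_neg_mul_sq_norm hs).comp_add_right b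

/-- A fixed portion of the mass of a Gaussian is outside of a ball, uniformly in its center. -/
theorem exists_setIntegral_gaussian_le (hd : 0 < d) {R : ℝ} (hR : 0 < R) (s₀ : ℝ) :
    ∃ θ, 0 < θ ∧ θ < 1 ∧ ∀ (s : ℝ) (b : Eucl d), 0 < s → s ≤ s₀ →
      ∫ x in Metric.closedBall (0 : Eucl d) R, Real.exp (-s * ‖x + b‖ ^ 2) ≤
        θ * ∫ x : Eucl d, Real.exp (-s * ‖x + b‖ ^ 2) := by
  -- A shift by length `3R` in either direction moves the ball of radius `R` off itself.
  set v : Eucl d := EuclideanSpace.single ⟨0, hd⟩ (3 * R) with hv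
  have hvn : ‖v‖ = 3 * R := by simp [hv, abs_of_pos hR]
  set E := Real.exp (s₀ * ‖v‖ ^ 2) with hE
  have hE0 : 0 < E := Real.exp_pos _
  refine ⟨2 * E / (1 + 2 * E), by positivity, by rw [div_lt_one (by positivity)]; linarith, ?_⟩
  intro s b hs hs₀
  set B := Metric.closedBall (0 : Eucl d) R with hB
  have hBm : MeasurableSet B := Metric.isClosed_closedBall.measurableSet
  set f : Eucl d → ℝ := fun x => Real.exp (-s * ‖x + b‖ ^ 2) with hf
  have hfi : Integrable f := integrable_exp_neg_mul_norm_add_sq hs b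
  have hshift (w : Eucl d) (hw : ‖w‖ = 3 * R) : ∫ x in B, f (x + w) ≤ ∫ x in Bᶜ, f x := by
    rw [← integral_indicator hBm, ← integral_indicator hBm.compl,
      ← integral_add_right_eq_self (Bᶜ.indicator f) w]
    refine integral_mono ((hfi.comp_add_right w).indicator hBm)
      ((hfi.indicator hBm.compl).comp_add_right w) fun x => ?_
    by_cases hx : x ∈ B
    · have hxw : x + w ∈ Bᶜ := by
        simp only [hB, mem_compl_iff, Metric.mem_closedBall, dist_zero_right] at hx ⊢
        have := norm_sub_norm_le w (-x)
        rw [norm_neg, sub_neg_eq_add, add_comm w x] at this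
        linarith
      simp [hx, hxw]
    · simp only [hx, not_false_eq_true, indicator_of_notMem]
      exact indicator_nonneg (fun _ _ => (Real.exp_pos _).le) _
  -- One of the shifts `±v` has a nonpositive inner product with `x + b`; along it `‖x + b‖²` grows
  -- by at most `‖v‖²`.
  have hpt (x : Eucl d) : f x ≤ E * (f (x + v) + f (x + -v)) := by
    have e1 : ‖x + v + b‖ ^ 2 = ‖x + b‖ ^ 2 + 2 * inner ℝ (x + b) v + ‖v‖ ^ 2 := by
      rw [← norm_add_sq_real]
      congr 2
      abel
    have e2 : ‖x + -v + b‖ ^ 2 = ‖x + b‖ ^ 2 - 2 * inner ℝ (x + b) v + ‖v‖ ^ 2 := by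
      rw [← norm_sub_sq_real]
      congr 2
      abel
    have hsv : s * ‖v‖ ^ 2 ≤ s₀ * ‖v‖ ^ 2 := by gcongr
    have h1 := (Real.exp_pos (-s * ‖x + v + b‖ ^ 2)).le
    have h2 := (Real.exp_pos (-s * ‖x + -v + b‖ ^ 2)).le
    rcases le_total 0 (inner ℝ (x + b) v) with hi | hi
    · calc f x ≤ E * f (x + -v) := by
            simp only [hf, hE]
            rw [← Real.exp_add, e2]
            apply Real.exp_le_exp.2
            nlinarith
        _ ≤ _ := by
          gcongr
          linarith
    · calc f x ≤ E * f (x + v) := by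
            simp only [hf, hE]
            rw [← Real.exp_add, e1]
            apply Real.exp_le_exp.2
            nlinarith
        _ ≤ _ := by
          gcongr
          linarith
  have h1 : ∫ x in B, f x ≤ E * ((∫ x in B, f (x + v)) + ∫ x in B, f (x + -v)) := by
    rw [← integral_add (hfi.comp_add_right v).integrableOn (hfi.comp_add_right (-v)).integrableOn,
      ← integral_const_mul]
    exact integral_mono hfi.integrableOn
      (((hfi.comp_add_right v).integrableOn.add (hfi.comp_add_right (-v)).integrableOn).const_mul E)
      hpt
  have h2 := hshift v hvn
  have h3 := hshift (-v) (by rw [norm_neg, hvn])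
  have h4 := integral_add_compl hBm hfi
  have h5 : ∫ x in B, f x ≤ 2 * E * ∫ x in Bᶜ, f x := by nlinarith
  -- From inside mass at most `2E` times outside mass, the inside share is at most `2E/(1 + 2E)`.
  rw [div_mul_eq_mul_div, le_div_iff₀ (by positivity), ← h4]
  linarith

/-- Separates the overlap of two Gaussians, governed by the distance of their centers, from a single
Gaussian at the midpoint. -/
theorem norm_sq_add_norm_sq_eq (p q : Eucl d) :
    ‖p‖ ^ 2 + ‖q‖ ^ 2 = ‖p - q‖ ^ 2 / 2 + 2 * ‖(1 / 2 : ℝ) • (p + q)‖ ^ 2 := by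
  rw [norm_smul, mul_pow, norm_add_sq_real, norm_sub_sq_real]
  norm_num
  ring

set_option maxHeartbeats 1000000 in
/-- The interaction of two moving Gaussians inside a ball, compared with their initial total
interaction. -/
theorem exists_pair_interaction_le (hd : 0 < d) {R : ℝ} (hR : 0 < R) :
    ∃ θ ε : ℝ, 0 < θ ∧ θ < 1 ∧ 0 < ε ∧ ε ≤ 1 / 16 ∧ ∀ (y z S : ℝ) (a b : Eucl d),
      |y - 1| ≤ ε → |z| ≤ ε → ‖a - b‖ ≤ S → S / 2 ≤ ‖(1 / 2 : ℝ) • (a + b)‖ →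
      (y ^ 2 * (1 + 16 * z ^ 2)⁻¹) ^ (d / 2 : ℝ) *
          ∫ x in Metric.closedBall (0 : Eucl d) R,
            Real.exp (-((1 + 16 * z ^ 2)⁻¹ * (‖y • x + a‖ ^ 2 + ‖y • x + b‖ ^ 2))) ≤
        θ * ∫ x : Eucl d, Real.exp (-(‖x + a‖ ^ 2 + ‖x + b‖ ^ 2)) := by
  -- The 8 bounds the exponent rate `2y²μ` met below, where `y ≤ 2` and `μ ≤ 1`.
  obtain ⟨θ, hθ0, hθ1, hθ⟩ := exists_setIntegral_gaussian_le hd hR 8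
  set B := Metric.closedBall (0 : Eucl d) R with hB
  have hBm : MeasurableSet B := Metric.isClosed_closedBall.measurableSet
  set V := volume.real B with hV
  have hV0 : 0 ≤ V := measureReal_nonneg
  set Z := (Real.pi / 2) ^ (d / 2 : ℝ) with hZ
  have hZ0 : 0 < Z := by positivity
  -- threshold for the spread
  set δ := (1 / 2) * Z / ((4 : ℝ) ^ (d / 2 : ℝ) * (V + 1)) with hδ
  have hδ0 : 0 < δ := by positivity
  -- Beyond spread `A`, the tail `exp(-A²/20)` is below `δ`, and `8R ≤ A` keeps the ball away from
  -- the midpoints.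
  set A := 8 * R + 20 * |Real.log δ| + 20 with hA
  have hA0 : 0 < A := by positivity
  have hAδ : Real.exp (-(A ^ 2 / 20)) ≤ δ := by
    rw [← Real.le_log_iff_exp_le hδ0]
    have h1 := neg_abs_le (Real.log δ)
    have h2 := abs_nonneg (Real.log δ)
    have h3 : 20 * |Real.log δ| ≤ A := by linarith
    have h4 : 20 ≤ A := by linarith
    nlinarith [mul_le_mul h3 h4 (by norm_num) hA0.le]
  -- The room between `θ` and the final factor `(1 + θ)/2`, on a logarithmic scale; `ε` is chosen so
  -- that the overlap loss for spread up to `A` fits in it.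
  set L := Real.log ((1 + θ) / (2 * θ)) with hL
  have hL0 : 0 < L := Real.log_pos (by rw [lt_div_iff₀ (by positivity)]; linarith)
  set ε := min (1 / 16) (L / (8 * A ^ 2)) with hε
  have hε0 : 0 < ε := by positivity
  have hε1 : ε ≤ 1 / 16 := min_le_left _ _
  have hε2 : 8 * ε * A ^ 2 ≤ L := by
    have := min_le_right (1 / 16) (L / (8 * A ^ 2))
    rw [← hε, le_div_iff₀ (by positivity)] at this
    linarith
  refine ⟨(1 + θ) / 2, ε, by positivity, by linarith, hε0, hε1, ?_⟩
  intro y z S a b hy hz hab hS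
  set μ := (1 + 16 * z ^ 2)⁻¹ with hμ
  have hz2 : z ^ 2 ≤ ε * (1 / 16) := by
    rw [← sq_abs, pow_two]
    exact mul_le_mul hz (hz.trans hε1) (abs_nonneg _) hε0.le
  have hμ0 : 0 < μ := by positivity
  have hμ1 : μ ≤ 1 := inv_le_one_of_one_le₀ (by nlinarith [sq_nonneg z])
  have hμε : 1 - ε ≤ μ := by
    rw [hμ, le_inv_comm₀ (by linarith) (by positivity)]
    rw [← one_div, le_div_iff₀ (by linarith)]
    nlinarith [sq_nonneg z]
  have hμ9 : 15 / 16 ≤ μ := by linarith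
  obtain ⟨hy1, hy2⟩ := abs_le.1 hy
  have hy0 : 0 < y := by linarith
  have hy2' : y ≤ 2 := by linarith
  set D := ‖a - b‖ with hD
  have hD0 : 0 ≤ D := norm_nonneg _
  set m := (1 / 2 : ℝ) • (a + b) with hm
  have hsplit (x : Eucl d) : ‖y • x + a‖ ^ 2 + ‖y • x + b‖ ^ 2 =
      D ^ 2 / 2 + 2 * ‖y • x + m‖ ^ 2 := by
    rw [norm_sq_add_norm_sq_eq, hD, hm]
    congr 3
    · congr 1
      abel
    · congr 2
      module
  have hsplit1 (x : Eucl d) : ‖x + a‖ ^ 2 + ‖x + b‖ ^ 2 = D ^ 2 / 2 + 2 * ‖x + m‖ ^ 2 := by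
    rw [norm_sq_add_norm_sq_eq, hD, hm]
    congr 3
    · congr 1
      abel
    · congr 2
      module
  have htot : ∫ x : Eucl d, Real.exp (-(‖x + a‖ ^ 2 + ‖x + b‖ ^ 2)) =
      Real.exp (-(D ^ 2 / 2)) * Z := by
    rw [hZ, ← integral_exp_neg_mul_norm_add_sq two_pos m, ← integral_const_mul]
    congr 1
    ext x
    rw [hsplit1, ← Real.exp_add]
    congr 1
    ring
  have hscale (x : Eucl d) : ‖y • x + m‖ ^ 2 = y ^ 2 * ‖x + y⁻¹ • m‖ ^ 2 := by
    have : y • x + m = y • (x + y⁻¹ • m) := by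
      rw [smul_add, smul_smul, mul_inv_cancel₀ hy0.ne', one_smul]
    rw [this, norm_smul, mul_pow, Real.norm_eq_abs, sq_abs]
  rw [htot]
  set lam := y ^ 2 * μ with hlam
  have hlam0 : 0 < lam := by positivity
  have hlam4 : lam ≤ 4 := by
    calc lam ≤ 2 ^ 2 * 1 := by rw [hlam]; gcongr
      _ = 4 := by norm_num
  -- Bounded spread: use the single-Gaussian estimate, with the powers of `lam` cancelling. Large
  -- spread: use a pointwise tail bound on the ball.
  rcases le_total S A with hSA | hSA
  · have e1 (x : Eucl d) : Real.exp (-(μ * (‖y • x + a‖ ^ 2 + ‖y • x + b‖ ^ 2))) =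
        Real.exp (-(μ * (D ^ 2 / 2))) * Real.exp (-(2 * lam) * ‖x + y⁻¹ • m‖ ^ 2) := by
      rw [hsplit, hscale, ← Real.exp_add, hlam]
      congr 1
      ring
    simp only [e1]
    rw [integral_const_mul]
    have h1 := hθ (2 * lam) (y⁻¹ • m) (by positivity) (by linarith)
    rw [integral_exp_neg_mul_norm_add_sq (by positivity)] at h1
    have h2 : lam ^ (d / 2 : ℝ) * (Real.pi / (2 * lam)) ^ (d / 2 : ℝ) = Z := by
      rw [← Real.mul_rpow hlam0.le (by positivity), hZ]
      congr 1
      field_simp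
    have h3 : Real.exp (-(μ * (D ^ 2 / 2))) ≤ (1 + θ) / (2 * θ) * Real.exp (-(D ^ 2 / 2)) := by
      rw [← Real.exp_log (show 0 < (1 + θ) / (2 * θ) by positivity), ← Real.exp_add, ← hL]
      apply Real.exp_le_exp.2
      have hDA : D ^ 2 ≤ A ^ 2 := by
        have := hab.trans hSA
        gcongr
      have : (1 - μ) * D ^ 2 ≤ ε * A ^ 2 := by
        apply mul_le_mul (by linarith) hDA (by positivity) hε0.le
      nlinarith
    calc lam ^ (d / 2 : ℝ) * (Real.exp (-(μ * (D ^ 2 / 2))) *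
          ∫ x in B, Real.exp (-(2 * lam) * ‖x + y⁻¹ • m‖ ^ 2))
        ≤ lam ^ (d / 2 : ℝ) * (((1 + θ) / (2 * θ) * Real.exp (-(D ^ 2 / 2))) *
          (θ * (Real.pi / (2 * lam)) ^ (d / 2 : ℝ))) := by
          gcongr
      _ = (1 + θ) / (2 * θ) * θ * Real.exp (-(D ^ 2 / 2)) *
          (lam ^ (d / 2 : ℝ) * (Real.pi / (2 * lam)) ^ (d / 2 : ℝ)) := by ring
      _ = (1 + θ) / 2 * (Real.exp (-(D ^ 2 / 2)) * Z) := by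
        rw [h2]
        field_simp
  · have hS0 : 0 < S := hA0.trans_le hSA
    have hSR : 8 * R ≤ S := by
      have := abs_nonneg (Real.log δ)
      linarith
    have h1 : ∫ x in B, Real.exp (-(μ * (‖y • x + a‖ ^ 2 + ‖y • x + b‖ ^ 2))) ≤
        ∫ _ in B, Real.exp (-(D ^ 2 / 2)) * δ := by
      refine integral_mono_of_nonneg (Eventually.of_forall fun x => (Real.exp_pos _).le)
        (integrableOn_const (by rw [hB]; exact measure_closedBall_lt_top.ne)) ?_
      filter_upwards [ae_restrict_mem hBm] with x hx
      refine le_trans ?_ (mul_le_mul_of_nonneg_left hAδ (Real.exp_pos _).le)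
      rw [← Real.exp_add, hsplit]
      apply Real.exp_le_exp.2
      have hx' : ‖x‖ ≤ R := by simpa [hB] using hx
      have h2 : S / 4 ≤ ‖y • x + m‖ := by
        have h3 := norm_sub_norm_le m (-(y • x))
        rw [norm_neg, sub_neg_eq_add, add_comm m, norm_smul y x, Real.norm_of_nonneg hy0.le] at h3
        have : y * ‖x‖ ≤ 2 * R := mul_le_mul hy2' hx' (norm_nonneg _) (by norm_num)
        linarith
      have h3 : (S / 4) ^ 2 ≤ ‖y • x + m‖ ^ 2 := by gcongr
      have h4 : D ^ 2 ≤ S ^ 2 := by gcongr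
      have h5 : A ^ 2 ≤ S ^ 2 := by gcongr
      have h6 : (1 - μ) * D ^ 2 ≤ 1 / 16 * S ^ 2 := by
        apply mul_le_mul (by linarith) h4 (by positivity) (by norm_num)
      have h7 : 15 / 16 * (S / 4) ^ 2 ≤ μ * ‖y • x + m‖ ^ 2 :=
        mul_le_mul hμ9 h3 (by positivity) hμ0.le
      -- The gain `2μ(S/4)² ≥ 15S²/128` exceeds the overlap loss, at most `S²/32`, by more than
      -- `S²/20 ≥ A²/20`.
      linarith [sq_nonneg S]
    rw [setIntegral_const, smul_eq_mul, ← hV] at h1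
    calc lam ^ (d / 2 : ℝ) * ∫ x in B, Real.exp (-(μ * (‖y • x + a‖ ^ 2 + ‖y • x + b‖ ^ 2)))
        ≤ 4 ^ (d / 2 : ℝ) * ((V + 1) * (Real.exp (-(D ^ 2 / 2)) * δ)) := by
          refine mul_le_mul (by gcongr) (h1.trans (by gcongr; linarith))
            (integral_nonneg fun x => (Real.exp_pos _).le) (by positivity)
      _ = 1 / 2 * (Real.exp (-(D ^ 2 / 2)) * Z) := by
        rw [hδ]
        field_simp
      _ ≤ _ := by
        gcongr
        linarith

theorem integrable_exp_neg_pair (a b : Eucl d) :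
    Integrable fun x : Eucl d => Real.exp (-(‖x + a‖ ^ 2 + ‖x + b‖ ^ 2)) := by
  refine (integrable_exp_neg_mul_norm_add_sq one_pos a).mono'
    (by fun_prop) (Eventually.of_forall fun x => ?_)
  rw [Real.norm_of_nonneg (Real.exp_pos _).le]
  apply Real.exp_le_exp.2
  nlinarith [sq_nonneg ‖x + b‖]

/-- Pairwise bounds on interactions give a bound on superpositions with nonnegative weights. -/
theorem setIntegral_sum_sq_le {ι : Type*} (s : Finset ι) {c : ι → ℝ} (hc : ∀ n ∈ s, 0 ≤ c n)
    (a : ι → Eucl d) {R θ y μ ρ : ℝ}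
    (h : ∀ n ∈ s, ∀ m ∈ s, ρ ^ 2 * ∫ x in Metric.closedBall (0 : Eucl d) R,
      Real.exp (-(μ * (‖y • x + a n‖ ^ 2 + ‖y • x + a m‖ ^ 2))) ≤
        θ * ∫ x : Eucl d, Real.exp (-(‖x + a n‖ ^ 2 + ‖x + a m‖ ^ 2))) :
    ∫ x in Metric.closedBall (0 : Eucl d) R,
        (∑ n ∈ s, c n * (ρ * Real.exp (-(μ * ‖y • x + a n‖ ^ 2)))) ^ 2 ≤
      θ * ∫ x : Eucl d, (∑ n ∈ s, c n * Real.exp (-‖x + a n‖ ^ 2)) ^ 2 := by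
  have e1 (x : Eucl d) : (∑ n ∈ s, c n * (ρ * Real.exp (-(μ * ‖y • x + a n‖ ^ 2)))) ^ 2 =
      ∑ n ∈ s, ∑ m ∈ s, c n * c m * (ρ ^ 2 *
        Real.exp (-(μ * (‖y • x + a n‖ ^ 2 + ‖y • x + a m‖ ^ 2)))) := by
    rw [sq, Finset.sum_mul_sum]
    refine Finset.sum_congr rfl fun n _ => Finset.sum_congr rfl fun m _ => ?_
    rw [mul_add, neg_add, Real.exp_add]
    ring
  have e2 (x : Eucl d) : (∑ n ∈ s, c n * Real.exp (-‖x + a n‖ ^ 2)) ^ 2 =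
      ∑ n ∈ s, ∑ m ∈ s, c n * c m * Real.exp (-(‖x + a n‖ ^ 2 + ‖x + a m‖ ^ 2)) := by
    rw [sq, Finset.sum_mul_sum]
    refine Finset.sum_congr rfl fun n _ => Finset.sum_congr rfl fun m _ => ?_
    rw [neg_add, Real.exp_add]
    ring
  have i1 (n m : ι) : Integrable (fun x : Eucl d => c n * c m * (ρ ^ 2 *
      Real.exp (-(μ * (‖y • x + a n‖ ^ 2 + ‖y • x + a m‖ ^ 2)))))
      (volume.restrict (Metric.closedBall (0 : Eucl d) R)) :=
    ContinuousOn.integrableOn_compact (isCompact_closedBall _ _) (by fun_prop)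
  have i2 (n m : ι) : Integrable (fun x : Eucl d =>
      c n * c m * Real.exp (-(‖x + a n‖ ^ 2 + ‖x + a m‖ ^ 2))) :=
    (integrable_exp_neg_pair _ _).const_mul _
  simp only [e1, e2]
  rw [integral_finsetSum _ fun n _ => integrable_finsetSum _ fun m _ => i1 n m,
    integral_finsetSum _ fun n _ => integrable_finsetSum _ fun m _ => i2 n m, Finset.mul_sum]
  refine Finset.sum_le_sum fun n hn => ?_
  rw [integral_finsetSum _ fun m _ => i1 n m, integral_finsetSum _ fun m _ => i2 n m,
    Finset.mul_sum]
  refine Finset.sum_le_sum fun m hm => ?_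
  rw [integral_const_mul, integral_const_mul, integral_const_mul]
  have := mul_le_mul_of_nonneg_left (h n hn m hm) (mul_nonneg (hc n hn) (hc m hm))
  linarith

/-! ### Coefficient norms and the placement of the centers. -/

theorem abs_le_supNormOn {T : ℝ} {κ : ℝ → ℝ} (hκ : ContinuousOn κ (Icc 0 T)) {t : ℝ}
    (ht : t ∈ Icc 0 T) : |κ t| ≤ supNormOn T κ := by
  obtain ⟨C, hC⟩ := isCompact_Icc.exists_bound_of_continuousOn hκ
  refine le_ciSup (f := fun t : Icc (0 : ℝ) T => |κ t|) ⟨C, ?_⟩ ⟨t, ht⟩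
  rintro _ ⟨s, rfl⟩
  exact hC s s.2

theorem supNormOn_nonneg (T : ℝ) (κ : ℝ → ℝ) : 0 ≤ supNormOn T κ :=
  Real.iSup_nonneg fun _ => abs_nonneg _

/-- The values 1 and 0 are those of `y₂` and `y₃` at `t = 0`, where the logarithm vanishes. -/
theorem three_half_spread_le_placementBound {S D : ℝ} (hD : 0 ≤ D) :
    3 / 2 * S ≤ placementBound S D 1 0 := by
  have : S / 2 ≤ Real.sqrt ((S ^ 2 + 2) / 4) := by
    apply Real.le_sqrt_of_sq_le
    nlinarith
  have e : placementBound S D 1 0 = Real.sqrt ((S ^ 2 + 2) / 4) + S + D / 2 := by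
    rw [placementBound]
    norm_num
  linarith

theorem norm_sub_le_spread {N : ℕ} (a : (Fin d → ℕ) → Eucl d) {n m : Fin d → ℕ}
    (hn : n ∈ multiIndices d N) (hm : m ∈ multiIndices d N) : ‖a n - a m‖ ≤ spread N a := by
  have := Finset.le_sup (f := fun q : (Fin d → ℕ) × (Fin d → ℕ) => ‖a q.1 - a q.2‖₊)
    (Finset.mk_mem_product hn hm)
  exact_mod_cast this

/-- A midpoint of two centers lies within one spread of the farthest center, which has norm at least
`3/2` of the spread. -/
theorem half_spread_le_norm_midpoint {N : ℕ} (a : (Fin d → ℕ) → Eucl d)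
    (h : 3 / 2 * spread N a ≤ maxCenter N a) {n m : Fin d → ℕ}
    (hn : n ∈ multiIndices d N) (hm : m ∈ multiIndices d N) :
    spread N a / 2 ≤ ‖(1 / 2 : ℝ) • (a n + a m)‖ := by
  obtain ⟨k, hk, hkm⟩ := Finset.exists_mem_eq_sup (multiIndices d N) ⟨n, hn⟩ fun n => ‖a n‖₊
  have hkm' : maxCenter N a = ‖a k‖ := by
    rw [maxCenter, hkm]
    rfl
  have h1 := norm_sub_le_spread a hk hn
  have h2 := norm_sub_le_spread a hk hm
  have h3 : ‖a k - (1 / 2 : ℝ) • (a n + a m)‖ ≤ spread N a := by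
    have : a k - (1 / 2 : ℝ) • (a n + a m) =
        (1 / 2 : ℝ) • (a k - a n) + (1 / 2 : ℝ) • (a k - a m) := by module
    rw [this]
    refine (norm_add_le _ _).trans ?_
    rw [norm_smul, norm_smul]
    norm_num
    linarith
  have h4 := norm_sub_norm_le (a k) ((1 / 2 : ℝ) • (a n + a m))
  linarith

/-! ### Mass in the observed region. -/

theorem norm_sq_LpToLpRestrictCLM (s : Set (Eucl d)) (f : L2 d) :
    ‖LpToLpRestrictCLM (Eucl d) ℂ ℂ volume 2 s f‖ ^ 2 = ∫ x in s, ‖f x‖ ^ 2 := by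
  rw [L2.norm_sq_eq_integral]
  refine integral_congr_ae ?_
  filter_upwards [LpToLpRestrictCLM_coeFn ℂ s f] with x hx
  rw [hx]

theorem L2.integrable_norm_sq (f : L2 d) : Integrable fun x => ‖f x‖ ^ 2 :=
  (memLp_two_iff_integrable_sq_norm (Lp.aestronglyMeasurable f)).1 (Lp.memLp f)

theorem norm_LpToLpRestrictCLM_le (s : Set (Eucl d)) (f : L2 d) :
    ‖LpToLpRestrictCLM (Eucl d) ℂ ℂ volume 2 s f‖ ≤ ‖f‖ := by
  rw [← sq_le_sq₀ (norm_nonneg _) (norm_nonneg _), norm_sq_LpToLpRestrictCLM,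
    L2.norm_sq_eq_integral]
  exact setIntegral_le_integral (L2.integrable_norm_sq f)
    (Eventually.of_forall fun x => by positivity)

/-- A superposition of Gaussian solutions keeps a fixed portion of its mass outside of a ball. -/
theorem exists_gaussianSum_path {τ : ℝ} (hτ : 0 ≤ τ) {κ₁ κ₂ y₁ y₂ y₃ : ℝ → ℝ}
    (hy : IsRiccatiSolution τ κ₁ κ₂ y₁ y₂ y₃)
    (hκ₁ : ContinuousOn κ₁ (Icc 0 τ)) (hκ₂ : ContinuousOn κ₂ (Icc 0 τ))
    (hy₂ : ∀ t ∈ Icc 0 τ, 1 / 2 ≤ y₂ t) (hy₃ : ∀ t ∈ Icc 0 τ, |y₃ t| ≤ 1)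
    {N : ℕ} {c : (Fin d → ℕ) → ℝ} (hc : ∀ n ∈ multiIndices d N, 0 ≤ c n)
    (a : (Fin d → ℕ) → Eucl d) {R θ : ℝ} {K : Set (Eucl d)} (hK : IsClosed K)
    (hKR : K ⊆ Metric.closedBall 0 R)
    (hpair : ∀ t ∈ Icc 0 τ, ∀ n ∈ multiIndices d N, ∀ m ∈ multiIndices d N,
      (y₂ t ^ 2 * (1 + 16 * y₃ t ^ 2)⁻¹) ^ (d / 2 : ℝ) *
        ∫ x in Metric.closedBall (0 : Eucl d) R, Real.exp (-((1 + 16 * y₃ t ^ 2)⁻¹ *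
          (‖y₂ t • x + a n‖ ^ 2 + ‖y₂ t • x + a m‖ ^ 2))) ≤
        θ * ∫ x : Eucl d, Real.exp (-(‖x + a n‖ ^ 2 + ‖x + a m‖ ^ 2))) :
    ∃ v : ℝ → L2 d, IsSchrodingerPath τ κ₁ κ₂ v ∧
      (v 0 =ᵐ[volume] fun x => (gaussianSum N a c x : ℂ)) ∧
      ∀ t ∈ Icc 0 τ, (1 - θ) * ‖v 0‖ ^ 2 ≤
        ‖LpToLpRestrictCLM (Eucl d) ℂ ℂ volume 2 Kᶜ (v t)‖ ^ 2 := by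
  choose g hg hg0 hgt using fun n : Fin d → ℕ =>
    hy.exists_gaussian_path hτ hκ₁ hκ₂ hy₂ hy₃ (a n)
  set v : ℝ → L2 d := fun t => ∑ n ∈ multiIndices d N, (c n : ℂ) • g n t with hv
  have hvp : IsSchrodingerPath τ κ₁ κ₂ v :=
    IsSchrodingerPath.sum _ _ fun n _ => (hg n).const_smul _
  have hcoe (t : ℝ) : ∀ᵐ x, v t x = ∑ n ∈ multiIndices d N, (c n : ℂ) * g n t x := by
    have h1 : ∀ᵐ x, ∀ n ∈ multiIndices d N, ((c n : ℂ) • g n t) x = (c n : ℂ) • g n t x :=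
      (ae_ball_iff (Finset.countable_toSet _)).2 fun n _ => Lp.coeFn_smul _ _
    filter_upwards [h1, Lp.coeFn_finsetSum (multiIndices d N) fun n => (c n : ℂ) • g n t]
      with x h1 h2
    rw [hv, h2, Finset.sum_apply]
    exact Finset.sum_congr rfl fun n hn => by rw [h1 n hn, smul_eq_mul]
  have hv0 : v 0 =ᵐ[volume] fun x => (gaussianSum N a c x : ℂ) := by
    have h1 : ∀ᵐ x, ∀ n ∈ multiIndices d N,
        g n 0 x = ((Real.exp (-‖x + a n‖ ^ 2) : ℝ) : ℂ) :=
      (ae_ball_iff (Finset.countable_toSet _)).2 fun n _ => hg0 n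
    filter_upwards [hcoe 0, h1] with x h2 h1
    rw [h2, gaussianSum, Complex.ofReal_sum]
    exact Finset.sum_congr rfl fun n hn => by rw [h1 n hn, Complex.ofReal_mul]
  refine ⟨v, hvp, hv0, fun t ht => ?_⟩
  set ρ := (y₂ t ^ 2 * (1 + 16 * y₃ t ^ 2)⁻¹) ^ (d / 4 : ℝ) with hρ
  have hρ2 : ρ ^ 2 = (y₂ t ^ 2 * (1 + 16 * y₃ t ^ 2)⁻¹) ^ (d / 2 : ℝ) := by
    rw [hρ, ← Real.rpow_natCast, ← Real.rpow_mul (by positivity)]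
    congr 1
    push_cast
    ring
  have hsum := setIntegral_sum_sq_le (multiIndices d N) hc a (R := R) (θ := θ) (y := y₂ t)
    (μ := (1 + 16 * y₃ t ^ 2)⁻¹) (ρ := ρ) (by rw [hρ2]; exact hpair t ht)
  have hnorm0 : ‖v 0‖ ^ 2 =
      ∫ x : Eucl d, (∑ n ∈ multiIndices d N, c n * Real.exp (-‖x + a n‖ ^ 2)) ^ 2 := by
    rw [L2.norm_sq_eq_integral]
    refine integral_congr_ae ?_
    filter_upwards [hv0] with x hx
    rw [hx, Complex.norm_real, Real.norm_eq_abs, sq_abs, gaussianSum]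
  have hball : ∫ x in K, ‖v t x‖ ^ 2 ≤ θ * ‖v 0‖ ^ 2 := by
    rw [hnorm0]
    refine le_trans ?_ hsum
    refine (setIntegral_mono_set (L2.integrable_norm_sq (v t)).integrableOn
      (Eventually.of_forall fun x => by positivity) (LE.le.eventuallyLE hKR)).trans ?_
    refine integral_mono_ae (L2.integrable_norm_sq (v t)).integrableOn
      (ContinuousOn.integrableOn_compact (isCompact_closedBall _ _) (by fun_prop)) ?_
    have h1 : ∀ᵐ x, ∀ n ∈ multiIndices d N, ‖g n t x‖ =
        ρ * Real.exp (-((1 + 16 * y₃ t ^ 2)⁻¹ * ‖y₂ t • x + a n‖ ^ 2)) :=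
      (ae_ball_iff (Finset.countable_toSet _)).2 fun n _ => hgt n t ht
    filter_upwards [ae_restrict_of_ae (hcoe t), ae_restrict_of_ae h1] with x h2 h1
    rw [h2]
    gcongr
    -- The triangle inequality drops the phases; the comparison term `‖v 0‖²` has none, all its
    -- summands being nonnegative.
    refine (norm_sum_le _ _).trans (Finset.sum_le_sum fun n hn => ?_)
    rw [norm_mul, Complex.norm_real, Real.norm_of_nonneg (hc n hn), h1 n hn]
  have htot := hvp.norm_eq ht
  have hsplit := integral_add_compl hK.measurableSet (L2.integrable_norm_sq (v t))
  rw [← L2.norm_sq_eq_integral, htot] at hsplit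
  rw [norm_sq_LpToLpRestrictCLM]
  linarith

/-- A lower bound for the observed norm from a lower bound on an initial time interval. -/
theorem sqrt_mul_le_observedNorm {T τ m : ℝ} (hτ : 0 ≤ τ) (hτT : τ ≤ T) (hm : 0 ≤ m)
    {ω : Set (Eucl d)} {u : ℝ → L2 d} (hu : ContinuousOn u (Icc 0 T))
    (h : ∀ t ∈ Ioo 0 τ, m ≤ ‖LpToLpRestrictCLM (Eucl d) ℂ ℂ volume 2 ω (u t)‖) :
    Real.sqrt τ * m ≤ observedNorm T ω u := by
  apply Real.le_sqrt_of_sq_le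
  simp only [← norm_sq_LpToLpRestrictCLM]
  have hc : ContinuousOn (fun t => ‖LpToLpRestrictCLM (Eucl d) ℂ ℂ volume 2 ω (u t)‖ ^ 2)
      (Icc 0 T) :=
    (((LpToLpRestrictCLM (Eucl d) ℂ ℂ volume 2 ω).continuous.comp_continuousOn hu).norm.pow 2)
  have hi : IntegrableOn (fun t => ‖LpToLpRestrictCLM (Eucl d) ℂ ℂ volume 2 ω (u t)‖ ^ 2)
      (Ioo 0 T) := (hc.integrableOn_compact isCompact_Icc).mono_set Ioo_subset_Icc_self
  have hsub : Ioo 0 τ ⊆ Ioo 0 T := Ioo_subset_Ioo_right hτT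
  calc (Real.sqrt τ * m) ^ 2 = ∫ _ in Ioo 0 τ, m ^ 2 := by
        rw [setIntegral_const, mul_pow, Real.sq_sqrt hτ]
        simp [hτ]
    _ ≤ ∫ t in Ioo 0 τ, ‖LpToLpRestrictCLM (Eucl d) ℂ ℂ volume 2 ω (u t)‖ ^ 2 := by
      refine setIntegral_mono_on (integrableOn_const (by simp)) (hi.mono_set hsub)
        measurableSet_Ioo fun t ht => ?_
      have := h t ht
      gcongr
    _ ≤ _ := setIntegral_mono_set hi (Eventually.of_forall fun t => by positivity)
      (LE.le.eventuallyLE hsub)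

end

theorem theorem3 (d : ℕ) (hd : 0 < d) (Ω : Set (Eucl d)) (hΩ_open : IsOpen Ω)
    (hΩ_conn : IsConnected Ω) (hΩ_bdd : Bornology.IsBounded Ω) (hΩ_cent : CenteredAtOrigin Ω)
    (T : ℝ) (hT : 0 < T) (M₁ M₂ : ℝ) :
    ∃ C : ℝ, 0 < C ∧
      ∀ κ₁ κ₂ : ℝ → ℝ,
        ContDiffOn ℝ 1 κ₁ (Icc 0 T) → (∃ k > 0, ∀ t ∈ Icc 0 T, k ≤ κ₁ t) →
        ContinuousOn κ₂ (Icc 0 T) → (∀ t ∈ Icc 0 T, 0 ≤ κ₂ t) →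
        c1NormOn T κ₁ ≤ M₁ → supNormOn T κ₂ ≤ M₂ →
        NonzeroHamiltonian d T κ₁ κ₂ →
        ∀ y₁ y₂ y₃ : ℝ → ℝ, IsRiccatiSolution T κ₁ κ₂ y₁ y₂ y₃ →
        ∀ (u₀ : L2 d) (N : ℕ) (η : ℝ) (a : (Fin d → ℕ) → Eucl d) (c : (Fin d → ℕ) → ℝ),
          IsAdmissibleWith u₀ N η a c →
          (∀ t ∈ Ico 0 T,
            maxCenter N a > placementBound (spread N a) (Metric.diam Ω) (y₂ t) (y₃ t)) →
          ∀ u : ℝ → L2 d, IsBValuedSolution T κ₁ κ₂ u₀ u →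
            ‖u₀‖ - η ≤ C * (observedNorm T (closure Ω)ᶜ u + T * η) := by
  obtain ⟨R, hR, hΩR⟩ : ∃ R, 0 < R ∧ closure Ω ⊆ Metric.closedBall 0 R := by
    obtain ⟨r, hr⟩ := hΩ_bdd.subset_closedBall 0
    refine ⟨max r 1, by positivity, closure_minimal ?_ Metric.isClosed_closedBall⟩
    exact hr.trans (Metric.closedBall_subset_closedBall (le_max_left _ _))
  obtain ⟨θ, ε, hθ0, hθ1, hε0, hε1, hpair⟩ := exists_pair_interaction_le hd hR
  set K := 8 * |M₁| + |M₂| + 1 with hK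
  have hK0 : 0 < K := by positivity
  -- `τ` depends on the coefficients only through `M₁` and `M₂`, so one constant serves the whole
  -- class.
  set τ := min T (ε / K) with hτ
  have hτ0 : 0 < τ := by positivity
  have hτT : τ ≤ T := min_le_left _ _
  have hKτ : K * τ ≤ ε := by
    have := min_le_right T (ε / K)
    rw [← hτ, le_div_iff₀ hK0] at this
    linarith
  set σ := Real.sqrt (1 - θ) with hσ
  have hσ0 : 0 < σ := Real.sqrt_pos.2 (by linarith)
  have hσ2 : σ ^ 2 = 1 - θ := Real.sq_sqrt (by linarith)
  have hsτ : 0 < Real.sqrt τ := Real.sqrt_pos.2 hτ0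
  -- The final estimate is `σ(‖u₀‖ - η) ≤ η + O/√τ`, with `O` the observed norm. Dividing by `σ` and
  -- writing `η = (Tη)/T` gives the two summands.
  refine ⟨1 / (σ * Real.sqrt τ) + 1 / (σ * T), by positivity, ?_⟩
  intro κ₁ κ₂ hκ₁ _ hκ₂ _ hM₁ hM₂ _ y₁ y₂ y₃ hy u₀ N η a c hadm hR1 u hu
  have hb₁ : ∀ t ∈ Icc 0 T, |κ₁ t| ≤ |M₁| := fun t ht => by
    have h1 := abs_le_supNormOn hκ₁.continuousOn ht
    have h2 := supNormOn_nonneg T (derivWithin κ₁ (Icc 0 T))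
    rw [c1NormOn] at hM₁
    linarith [le_abs_self M₁]
  have hb₂ : ∀ t ∈ Icc 0 T, |κ₂ t| ≤ |M₂| := fun t ht =>
    (abs_le_supNormOn hκ₂ ht).trans (hM₂.trans (le_abs_self M₂))
  have hsmall : ∀ t ∈ Icc 0 τ, |y₁ t| ≤ ε ∧ |y₂ t - 1| ≤ ε ∧ |y₃ t| ≤ ε := fun t ht =>
    hy.abs_sub_init_le (abs_nonneg _) (abs_nonneg _) hb₁ hb₂ (by linarith) hτT hKτ ht
  have hcenter : 3 / 2 * spread N a ≤ maxCenter N a := by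
    have h1 := hR1 0 ⟨le_rfl, hT⟩
    rw [hy.init₂, hy.init₃] at h1
    exact (three_half_spread_le_placementBound Metric.diam_nonneg).trans h1.le
  obtain ⟨v, hv, hv0, hvm⟩ := exists_gaussianSum_path (R := R) (θ := θ) (K := closure Ω) hτ0.le
    (hy.mono hτT) (hκ₁.continuousOn.mono (Icc_subset_Icc_right hτT))
    (hκ₂.mono (Icc_subset_Icc_right hτT))
    (fun t ht => by linarith [(abs_le.1 (hsmall t ht).2.1).1])
    (fun t ht => by linarith [(hsmall t ht).2.2]) hadm.coeff_nonneg a isClosed_closure hΩR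
    (fun t ht n hn m hm => hpair (y₂ t) (y₃ t) (spread N a) (a n) (a m) (hsmall t ht).2.1
      (hsmall t ht).2.2 (norm_sub_le_spread a hn hm) (half_spread_le_norm_midpoint a hcenter hn hm))
  have hup := hu.isSchrodingerPath hτT
  have hw0 : ‖u 0 - v 0‖ ≤ η := by
    refine le_trans (le_of_eq ?_) hadm.approx
    rw [← Real.sqrt_sq (norm_nonneg (u 0 - v 0)), L2.norm_sq_eq_integral, hu.initial]
    congr 1
    refine integral_congr_ae ?_
    filter_upwards [Lp.coeFn_sub u₀ (v 0), hv0] with x h1 h2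
    rw [h1, Pi.sub_apply, h2]
  have hw : ∀ t ∈ Icc 0 τ, ‖u t - v t‖ ≤ η := fun t ht =>
    ((hup.sub hv).norm_eq ht).trans_le hw0
  have hu0v : ‖u₀‖ - η ≤ ‖v 0‖ := by
    rw [hu.initial] at hw0
    linarith [norm_sub_norm_le u₀ (v 0)]
  set P := LpToLpRestrictCLM (Eucl d) ℂ ℂ volume 2 (closure Ω)ᶜ with hP
  have hlow : ∀ t ∈ Icc 0 τ, σ * (‖u₀‖ - η) - η ≤ ‖P (u t)‖ := by
    intro t ht
    have h1 : σ * ‖v 0‖ ≤ ‖P (v t)‖ := by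
      rw [← sq_le_sq₀ (by positivity) (norm_nonneg _), mul_pow, hσ2]
      exact hvm t ht
    have h2 : ‖P (v t)‖ - ‖P (u t)‖ ≤ η := by
      refine (norm_sub_norm_le _ _).trans ?_
      rw [← map_sub]
      refine (norm_LpToLpRestrictCLM_le _ _).trans ?_
      rw [norm_sub_rev]
      exact hw t ht
    have h3 := mul_le_mul_of_nonneg_left hu0v hσ0.le
    linarith
  have hfin : σ * (‖u₀‖ - η) ≤ η + observedNorm T (closure Ω)ᶜ u / Real.sqrt τ := by
    have hobs : 0 ≤ observedNorm T (closure Ω)ᶜ u := Real.sqrt_nonneg _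
    -- A nonpositive lower bound makes the claim trivial; a nonnegative one can be squared and
    -- integrated in time.
    rcases le_total (σ * (‖u₀‖ - η) - η) 0 with hm | hm
    · have : 0 ≤ observedNorm T (closure Ω)ᶜ u / Real.sqrt τ := by positivity
      linarith
    · have h1 := sqrt_mul_le_observedNorm hτ0.le hτT hm (hu.isSchrodingerPath le_rfl).continuousOn
        fun t ht => hlow t (Ioo_subset_Icc_self ht)
      have h2 : σ * (‖u₀‖ - η) - η ≤ observedNorm T (closure Ω)ᶜ u / Real.sqrt τ := by
        rw [le_div_iff₀ hsτ]
        linarith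
      linarith
  have hobs : 0 ≤ observedNorm T (closure Ω)ᶜ u := Real.sqrt_nonneg _
  have hη := hadm.eta_pos
  set O := observedNorm T (closure Ω)ᶜ u with hO
  calc ‖u₀‖ - η ≤ (η + O / Real.sqrt τ) / σ := by
        rw [le_div_iff₀ hσ0]
        linarith
    _ = 1 / (σ * Real.sqrt τ) * O + 1 / (σ * T) * (T * η) := by
      field_simp
      ring
    _ ≤ 1 / (σ * Real.sqrt τ) * (O + T * η) + 1 / (σ * T) * (O + T * η) := by
      gcongr
      · have : 0 ≤ T * η := by positivity
        linarith
      · linarith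
    _ = _ := by ring
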